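/- **Setting.** Let $d,S\ge 1$ be integers, let $q_0$ be a probability mass function on $[S]^d$, and let $(q_t)_{t\ge0}$ be the marginals of the continuous-time Markov chain on $[S]^d$ started from $q_0$ with rate matrix $R(x,y)=R_{\mathrm{base}}(x^i,y^i)$ if $x,y$ differ exactly in the $i$-th token, $R(x,y)=0$ if they differ in at least two tokens, and $R(x,x)=-\sum_{y\ne x}R(x,y)$, where $R_{\mathrm{base}}=\frac1S\mathbf 1\mathbf 1^{\mathsf T}-I_S$; that is, $q_t=q_0e^{tR}$. Let $0<\delta<T$, and let $0=t_0<t_1<\dots<t_N=T-\delta$. For each $k$ let $s_{T-t_k}(y,x)$ be an estimate of $q_{T-t_k}(y)/q_{T-t_k}(x)$, $x\ne y$. For $t>0$ put $$\mathcal L_{SE}(t;s)=\sum_{x}q_t(x)\sum_{y\neq x}R(y,x)\Big(s(y,x)-\tfrac{q_t(y)}{q_t(x)}-\tfrac{q_t(y)}{q_t(x)}\log\tfrac{s(y,x)}{q_t(y)/q_t(x)}\Big).$$ Assume 1. $\sum_{k=0}^{N-1}(t_{k+1}-t_k)\,\mathcal L_{SE}(T-t_k;s_{T-t_k})\le\varepsilon_{\mathrm{score}}$;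 2. $s_{T-t_k}(x,y)\in[M^{-1},M]$ for all $x\ne y$ and $0\le k<N$, where $M\ge1$. The $\tau$-leaping sampler starts from $x_{0}\sim\mathrm{Uniform}([S]^d)$ and, for $x_{t_k}\in[S]^d$, sets $$x_{t_{k+1}}=x_{t_k}+\sum_{i=1}^d e^i\sum_{a\in[S],\,a\ne x_{t_k}^i}(a-x_{t_k}^i)\,\mathrm{Pois}\big(\hat R_{t_k}(x_{t_k},x_{t_k}^{-i}\oplus_i a)(t_{k+1}-t_k)\big),\qquad \hat R_{t_k}(x,y)=R(y,x)\,s_{T-t_k}(y,x),$$ with independent Poisson variables, where $e^i$ is the $i$-th unit vector and $x^{-i}\oplus_i a$ is $x$ with its $i$-th entry replaced by $a$. A step may leave $[S]^d$; from points of $\mathbb Z^d\setminus[S]^d$ the sampler continues by an arbitrary Markov transition rule. Let $p_{T-\delta}$ be the law of $x_{t_N}$ on $\mathbb Z^d$, and regard $q_\delta$ as a law on $\mathbb Z^d$ supported on $[S]^d$. **Theorem.** There is a universal constant $C>0$ such that the following holds. (i) If $\kappa>0$ and $t_{k+1}-t_k\le\kappa\min\{1,T-t_k\}$ for all $0\le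 k<N$, then $$\mathrm{KL}(q_\delta\,\|\,p_{T-\delta})\le C\Big(d(\log S)e^{-T}+\varepsilon_{\mathrm{score}}+\kappa d^2S\big(T+\log(MS\delta^{-1})\big)\Big),\qquad \mathrm{TV}(q_0,q_\delta)\le C\,d\,\delta .$$ (ii) Let $\varepsilon>0$, $M\ge1$, $T=\log(d(\log S)/\varepsilon)$ and $0<\delta<T$. Then there are $N$, $\kappa>0$ and a grid $0=t_0<\dots<t_N=T-\delta$, depending only on $d,S,M,\delta,\varepsilon$, with $t_{k+1}-t_k=\kappa\min\{1,T-t_k\}$ for all $0\le k<N$ and $$N\le C\,\frac{d^2S}{\varepsilon}\,\log^2\!\Big(\frac{dSM}{\delta\varepsilon}\Big)=\tilde O(d^2S/\varepsilon),$$ such that for every $q_0$ and all score estimates satisfying 1 and 2 on this grid, $\mathrm{KL}(q_\delta\,\|\,p_{T-\delta})\le C(\varepsilon+\varepsilon_{\mathrm{score}})$. -/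

import Mathlib

open MeasureTheory ProbabilityTheory InformationTheory
open scoped NNReal ENNReal

namespace DiscreteDiffusion

noncomputable section

/-- The state space `[S]^d`: `d` tokens from a vocabulary of size `S` (labelled `0, …, S - 1`). -/
abbrev State (d S : ℕ) : Type := Fin d → Fin S

/-- The ambient lattice `ℤ^d`, on which `τ`-leaping moves. -/
abbrev Lattice (d : ℕ) : Type := Fin d → ℤ

/-- The inclusion `[S]^d ⊆ ℤ^d`. -/
def State.toLattice {d S : ℕ} (x : State d S) : Lattice d := fun i => ((x i : ℕ) : ℤ)

/-- The measure on `ℤ^d` with mass function `q`, supported on `[S]^d`. -/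
def massMeasure {d S : ℕ} (q : State d S → ℝ) : Measure (Lattice d) :=
  ∑ x : State d S, ENNReal.ofReal (q x) • Measure.dirac x.toLattice

/-- Total variation distance of two mass functions. -/
def tvDist {d S : ℕ} (p q : State d S → ℝ) : ℝ := (1 / 2) * ∑ x, |p x - q x|

/-! ### The forward process -/

/-- The token rate matrix `(1/S) 𝟏 𝟏ᵀ - I`. -/
def tokenRate (S : ℕ) : Matrix (Fin S) (Fin S) ℝ :=
  (1 / (S : ℝ)) • Matrix.of (fun _ _ => 1) - 1

/-- Off-diagonal entries of the forward rate matrix: tokens move one at a time. When the Hamming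
distance is `1`, the sum has exactly one term, the one of the token in which `x` and `y` differ. -/
def jumpRate {d S : ℕ} (x y : State d S) : ℝ :=
  if hammingDist x y = 1 then ∑ i with x i ≠ y i, tokenRate S (x i) (y i) else 0

/-- The forward rate matrix on `[S]^d`, with rows summing to zero. -/
def forwardRate (d S : ℕ) : Matrix (State d S) (State d S) ℝ :=
  Matrix.of fun x y => if x = y then -∑ z with z ≠ x, jumpRate x z else jumpRate x y

/-- The law `q_t = q_0 exp(t R)` at time `t` of the continuous-time Markov chain with rate matrix
`R` started from `q_0`. -/
def forwardLaw {d S : ℕ} (q₀ : State d S → ℝ) (t : ℝ) : State d S → ℝ :=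
  Matrix.vecMul q₀ (NormedSpace.exp (t • forwardRate d S))

/-! ### Score estimates -/

/-- The score-entropy loss at time `t` of the estimate `s y x` of `q_t(y) / q_t(x)`. -/
def scoreEntropy {d S : ℕ} (q₀ : State d S → ℝ) (t : ℝ) (s : State d S → State d S → ℝ) : ℝ :=
  ∑ x, forwardLaw q₀ t x * ∑ y with y ≠ x, forwardRate d S y x *
    (s y x - forwardLaw q₀ t y / forwardLaw q₀ t x
      - forwardLaw q₀ t y / forwardLaw q₀ t x *
          Real.log (s y x / (forwardLaw q₀ t y / forwardLaw q₀ t x)))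

/-- Time grid `0 = t_0 < t_1 < ⋯ < t_N = T - δ`. -/
structure IsGrid (T δ : ℝ) (N : ℕ) (t : ℕ → ℝ) : Prop where
  zero : t 0 = 0
  last : t N = T - δ
  lt_succ : ∀ k < N, t k < t (k + 1)

/-- The accumulated score-entropy loss on the grid is at most `εscore`. -/
def ScoreError {d S : ℕ} (q₀ : State d S → ℝ) (T : ℝ) (N : ℕ) (t : ℕ → ℝ)
    (s : ℝ → State d S → State d S → ℝ) (εscore : ℝ) : Prop :=
  ∑ k ∈ Finset.range N, (t (k + 1) - t k) * scoreEntropy q₀ (T - t k) (s (T - t k)) ≤ εscore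

/-- The score estimates used on the grid take values in `[1/M, M]`. -/
def ScoreBounded {d S : ℕ} (T : ℝ) (N : ℕ) (t : ℕ → ℝ)
    (s : ℝ → State d S → State d S → ℝ) (M : ℝ) : Prop :=
  ∀ k < N, ∀ x y : State d S, x ≠ y → s (T - t k) x y ∈ Set.Icc M⁻¹ M

/-! ### The `τ`-leaping sampler -/

/-- The estimated reverse rate `R(y,x) s(y,x)` of a jump from `x` to `y`. -/
def estRate {d S : ℕ} (s : State d S → State d S → ℝ) (x y : State d S) : ℝ :=
  forwardRate d S y x * s y x

/-- One `τ`-leaping step of length `h` from `x ∈ [S]^d`: the law of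
`x + ∑ i, e_i ∑ a, (a - x_i) Pois(h R̂(x, x with i-th token a))` with independent Poisson
variables. The terms with `a = x_i` vanish whatever their Poisson parameter is. -/
def tauLeapStep {d S : ℕ} (s : State d S → State d S → ℝ) (h : ℝ) (x : State d S) :
    Measure (Lattice d) :=
  (Measure.pi fun ia : Fin d × Fin S =>
      poissonMeasure (estRate s x (Function.update x ia.1 ia.2) * h).toNNReal).map
    fun n i => x.toLattice i + ∑ a : Fin S, (((a : ℕ) : ℤ) - x.toLattice i) * (n (i, a) : ℤ)

open Classical in
/-- The transition kernel on `ℤ^d` of one step of the sampler. On `[S]^d` it is `τ`-leaping. A step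
may leave `[S]^d`, where there is no score estimate; from such a point the sampler continues
according to `out`. -/
def tauLeapKernel {d S : ℕ} (s : State d S → State d S → ℝ) (h : ℝ)
    (out : Kernel (Lattice d) (Lattice d)) : Kernel (Lattice d) (Lattice d) :=
  Kernel.ofFunOfCountable fun z =>
    if hz : ∃ x : State d S, x.toLattice = z then tauLeapStep s h hz.choose else out z

/-- The law of the `τ`-leaping sampler at the grid point `t_k`, started from the uniform
distribution on `[S]^d`. -/
def tauLeapLaw {d S : ℕ} (T : ℝ) (t : ℕ → ℝ) (s : ℝ → State d S → State d S → ℝ)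
    (out : ℕ → Kernel (Lattice d) (Lattice d)) : ℕ → Measure (Lattice d)
  | 0 => massMeasure fun _ : State d S => 1 / (S : ℝ) ^ d
  | k + 1 => (tauLeapLaw T t s out k).bind
      (tauLeapKernel (s (T - t k)) (t (k + 1) - t k) (out k))

end

end DiscreteDiffusion

/-! No path-space change of measure is used: the comparison is a discrete chain rule for relative
entropy along the grid. Since `p_{T-δ}` enters the divergence through `-log`, a pointwise lower
bound on the sampler's law suffices. `leapKernel` keeps only the event that the Poisson variables
turning `x` into `y` equal one and the other relevant ones vanish. It is an explicit product over
tokens, as is the forward semigroup (`exp_smul_forwardRate`), so logarithms become sums over tokens.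
Excursions outside `[S]^d` merely lose mass.

The chain rule (`relEntropy_leapLaw_le`) leaves an initial error, the relative entropy of `q_T` to
uniform, at most `d log S · e^{-T}` (`negEntropy_forwardLaw_le`), plus one `stepError` per step.
Write `E` for the negative entropy of the forward law and `J = -E'`. Expanding the step from time `u
+ h` back to `u` (`stepError_le`) and substituting the expansion of the loss (`scoreEntropy_eq`)
bounds it by four terms: (a) `h` times the score-entropy loss; (b) `E(u) - E(u+h) - h J(u+h)`, the
error of a Riemann sum. `E` is convex because `J` is antitone, so these errors sum to `O(κ d log S)`
(`sum_convexity_error_le`); (c) a per-token Taylor remainder `O(h²)`; (d) the sum of `log s` against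
the difference between `h q_{u+h}` and the true law of a token change. For `h ≤ 1` the relative size
of this difference is `O(min(1, κ))` per unit time. The weighted sum of `|log s|` is at most the
loss plus `d(1 + log(1 + S/(u+h)))` (`edgeSum_abs_log_le`), so `log M` enters only when a step
longer than 1 ends at `u < log S`. Each resulting term telescopes along the grid, giving (i) with
room to spare.

For (ii), `κ` is found from a prescribed `N` by the intermediate value theorem. The potential `v +
log v` of the remaining time drops by at least `κ` per step, so `N κ` is at most `T + log T - δ -
log δ`, and `N` is chosen to make `κ d² S` times the logarithmic factor at most `ε`. -/

namespace DiscreteDiffusion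

noncomputable section

/-! ### The forward semigroup in product form -/

/-- The transition probabilities of one token after time `t`. -/
def tokenKernel {S : ℕ} (t : ℝ) (a b : Fin S) : ℝ :=
  Real.exp (-t) * (if a = b then 1 else 0) + (1 - Real.exp (-t)) / S

/-- The transition probabilities of `d` independent tokens after time `t`. -/
def prodKernel {d S : ℕ} (t : ℝ) (x y : State d S) : ℝ := ∏ i, tokenKernel t (x i) (y i)

variable {d S : ℕ}

lemma eq_update_iff_forall {x y : State d S} (i : Fin d) (b : Fin S) :
    y = Function.update x i b ↔ b = y i ∧ ∀ j, j ≠ i → y j = x j := by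
  rw [Function.eq_update_iff]
  exact ⟨fun h => ⟨h.1.symm, h.2⟩, fun h => ⟨h.1.symm, h.2⟩⟩

lemma hammingDist_eq_one_of_update {x y : State d S} (hxy : x ≠ y) {i : Fin d}
    (h : ∀ j, j ≠ i → y j = x j) : hammingDist x y = 1 := by
  have hi : x i ≠ y i := by
    intro hi
    apply hxy
    ext j
    by_cases hj : j = i
    · rw [hj, hi]
    · rw [h j hj]
  have : (Finset.univ.filter fun j => x j ≠ y j) = {i} := by
    ext j
    simp only [Finset.mem_filter, Finset.mem_univ, true_and, Finset.mem_singleton]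
    refine ⟨fun hj => by_contra fun hji => hj (h j hji).symm, fun hj => hj ▸ hi⟩
  rw [hammingDist, this, Finset.card_singleton]

/-- Two distinct states are related by at most one single-token replacement, so the double sum
counts 1 or 0. This form makes sums against the rate matrix into sums over updates. -/
lemma jumpRate_eq_sum {x y : State d S} (hxy : x ≠ y) :
    jumpRate x y = (1 / (S : ℝ)) * ∑ i, ∑ b, if y = Function.update x i b then 1 else 0 := by
  unfold jumpRate
  split_ifs with h
  · obtain ⟨i, hi⟩ := Finset.card_eq_one.1 h
    have hmem : ∀ j, x j ≠ y j ↔ j = i := fun j => by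
      have : j ∈ (Finset.univ.filter fun j => x j ≠ y j) ↔ j ∈ ({i} : Finset (Fin d)) := by rw [hi]
      simpa using this
    rw [hi, Finset.sum_singleton, Finset.sum_eq_single i, Finset.sum_eq_single (y i)]
    · rw [if_pos]
      · have := (hmem i).2 rfl
        simp [tokenRate, this]
      · rw [eq_update_iff_forall]
        refine ⟨rfl, fun j hj => by_contra fun hne => hj ((hmem j).1 (Ne.symm hne))⟩
    · intro b _ hb
      rw [if_neg]
      rw [eq_update_iff_forall]
      exact fun h => hb h.1
    · simp
    · intro j _ hj
      refine Finset.sum_eq_zero fun b _ => ?_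
      rw [if_neg]
      rw [eq_update_iff_forall]
      exact fun h => (hmem i).2 rfl (h.2 i (Ne.symm hj)).symm
    · simp
  · rw [Finset.sum_eq_zero, mul_zero]
    intro i _
    refine Finset.sum_eq_zero fun b _ => ?_
    rw [if_neg]
    rw [eq_update_iff_forall]
    exact fun hh => h (hammingDist_eq_one_of_update hxy hh.2)

lemma jumpRate_comm (x y : State d S) : jumpRate x y = jumpRate y x := by
  unfold jumpRate
  rw [hammingDist_comm]
  simp only [tokenRate, Matrix.sub_apply, Matrix.smul_apply, Matrix.of_apply, Matrix.one_apply,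
    ne_comm (a := x _), eq_comm (a := x _)]

lemma sum_ne_mul_jumpRate (f : State d S → ℝ) (x : State d S) :
    ∑ y with y ≠ x, f y * jumpRate x y =
      (1 / (S : ℝ)) * ∑ i, ∑ a with a ≠ x i, f (Function.update x i a) := by
  have h1 : ∑ y with y ≠ x, f y * jumpRate x y =
      ∑ y with y ≠ x, (1 / (S : ℝ)) * ∑ i, ∑ b, if y = Function.update x i b then f y else 0 := by
    refine Finset.sum_congr rfl fun y hy => ?_
    rw [jumpRate_eq_sum (Ne.symm (Finset.mem_filter.1 hy).2), mul_left_comm, Finset.mul_sum]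
    simp only [Finset.mul_sum, mul_ite, mul_one, mul_zero]
  rw [h1, ← Finset.mul_sum, Finset.sum_comm]
  congr 1
  refine Finset.sum_congr rfl fun i _ => ?_
  rw [Finset.sum_comm, Finset.sum_filter]
  refine Finset.sum_congr rfl fun b _ => ?_
  rw [Finset.sum_ite_eq']
  simp [Function.update_eq_self_iff]

lemma sum_ne_forwardRate_mul (f : State d S → ℝ) (x : State d S) :
    ∑ y with y ≠ x, forwardRate d S y x * f y =
      (1 / (S : ℝ)) * ∑ i, ∑ a with a ≠ x i, f (Function.update x i a) := by
  rw [← sum_ne_mul_jumpRate]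
  refine Finset.sum_congr rfl fun y hy => ?_
  have hy' : y ≠ x := (Finset.mem_filter.1 hy).2
  simp [forwardRate, hy', jumpRate_comm x y, mul_comm]

lemma sum_mul_forwardRate [NeZero S] (f : State d S → ℝ) (x : State d S) :
    ∑ y, f y * forwardRate d S y x =
      ∑ i, ((1 / (S : ℝ)) * ∑ b, f (Function.update x i b) - f x) := by
  have hdiag : forwardRate d S x x = -((1 / (S : ℝ)) * ∑ i, ∑ a with a ≠ x i, 1) := by
    rw [← sum_ne_mul_jumpRate (fun _ => 1) x]
    simp [forwardRate]
  rw [← Finset.add_sum_erase _ _ (Finset.mem_univ x), ← Finset.filter_ne']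
  have := sum_ne_forwardRate_mul f x
  simp only [mul_comm (forwardRate d S _ x)] at this
  rw [this, hdiag, Finset.mul_sum, Finset.mul_sum, mul_neg, Finset.mul_sum, neg_add_eq_sub,
    ← Finset.sum_sub_distrib]
  refine Finset.sum_congr rfl fun i _ => ?_
  have hS : (S : ℝ) ≠ 0 := Nat.cast_ne_zero.2 (NeZero.ne S)
  rw [← Finset.add_sum_erase Finset.univ (fun b => f (Function.update x i b)) (Finset.mem_univ (x i)),
    ← Finset.filter_ne', Function.update_eq_self]
  have hc : ((Finset.univ.filter fun a => a ≠ x i).card : ℝ) = S - 1 := by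
    rw [Finset.filter_ne', Finset.card_erase_of_mem (Finset.mem_univ _), Finset.card_univ,
      Fintype.card_fin, Nat.cast_sub (NeZero.pos S), Nat.cast_one]
  rw [Finset.sum_const, nsmul_eq_mul, hc]
  field_simp
  ring

lemma sum_tokenKernel [NeZero S] (t : ℝ) (a : Fin S) : ∑ b, tokenKernel t a b = 1 := by
  have hS : (S : ℝ) ≠ 0 := Nat.cast_ne_zero.2 (NeZero.ne S)
  simp only [tokenKernel, Finset.sum_add_distrib, ← Finset.mul_sum]
  simp
  field_simp
  ring

lemma tokenKernel_pos [NeZero S] {t : ℝ} (ht : 0 < t) (a b : Fin S) : 0 < tokenKernel t a b := by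
  have hS : (0 : ℝ) < S := Nat.cast_pos.2 (NeZero.pos S)
  have h1 : Real.exp (-t) < 1 := by rw [Real.exp_lt_one_iff]; linarith
  have h2 : 0 < (1 - Real.exp (-t)) / S := div_pos (by linarith) hS
  unfold tokenKernel
  split_ifs <;> positivity

lemma prodKernel_pos [NeZero S] {t : ℝ} (ht : 0 < t) (x y : State d S) : 0 < prodKernel t x y :=
  Finset.prod_pos fun _ _ => tokenKernel_pos ht _ _

lemma sum_prodKernel [NeZero S] (t : ℝ) (x : State d S) : ∑ y, prodKernel t x y = 1 := by
  unfold prodKernel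
  rw [← Fintype.prod_sum fun i b => tokenKernel t (x i) b]
  simp [sum_tokenKernel]

lemma prodKernel_eq_mul_erase (t : ℝ) (x y : State d S) (i : Fin d) :
    prodKernel t x y =
      tokenKernel t (x i) (y i) * ∏ j ∈ Finset.univ.erase i, tokenKernel t (x j) (y j) :=
  (Finset.mul_prod_erase _ _ (Finset.mem_univ i)).symm

lemma prod_erase_update (t : ℝ) (x y : State d S) (i : Fin d) (b : Fin S) :
    ∏ j ∈ Finset.univ.erase i, tokenKernel t (x j) (Function.update y i b j) =
      ∏ j ∈ Finset.univ.erase i, tokenKernel t (x j) (y j) :=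
  Finset.prod_congr rfl fun j hj => by rw [Function.update_of_ne (Finset.ne_of_mem_erase hj)]

lemma hasDerivAt_tokenKernel (t : ℝ) (a b : Fin S) :
    HasDerivAt (fun t => tokenKernel t a b) (1 / S - tokenKernel t a b) t := by
  have h : HasDerivAt (fun t : ℝ => Real.exp (-t)) (-Real.exp (-t)) t := by
    simpa using (hasDerivAt_neg t).exp
  have := (h.mul_const (if a = b then (1 : ℝ) else 0)).add ((h.const_sub 1).div_const (S : ℝ))
  convert! this using 1
  unfold tokenKernel
  ring

lemma hasDerivAt_prodKernel [NeZero S] (t : ℝ) (x y : State d S) :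
    HasDerivAt (fun t => prodKernel t x y)
      (∑ i, ((1 / (S : ℝ)) * ∑ b, prodKernel t x (Function.update y i b) - prodKernel t x y)) t := by
  have := HasDerivAt.fun_finsetProd (u := Finset.univ)
    (fun i _ => hasDerivAt_tokenKernel t (x i) (y i))
  convert! this using 1
  refine Finset.sum_congr rfl fun i _ => ?_
  simp only [prodKernel_eq_mul_erase t x _ i, prod_erase_update, Function.update_self,
    ← Finset.sum_mul, sum_tokenKernel, smul_eq_mul]
  ring

section

attribute [local instance] Matrix.linftyOpNormedRing Matrix.linftyOpNormedAlgebra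

/-- The product kernel `P` satisfies `P' = P R` and `P(0) = 1`, so `P(t) exp(-tR)` has zero
derivative and stays equal to the identity. -/
lemma exp_smul_forwardRate [NeZero S] (t : ℝ) :
    NormedSpace.exp (t • forwardRate d S) = Matrix.of (prodKernel t) := by
  set R := forwardRate d S
  have hP : ∀ t : ℝ, HasDerivAt
      (fun t : ℝ => (Matrix.of (prodKernel t) : Matrix (State d S) (State d S) ℝ))
      (Matrix.of (prodKernel t) * R) t := by
    intro t
    have : HasDerivAt (fun t : ℝ => (fun x y => prodKernel t x y : State d S → State d S → ℝ))
        (fun x y => ((Matrix.of (prodKernel t) : Matrix (State d S) (State d S) ℝ) * R) x y) t := by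
      rw [hasDerivAt_pi]
      intro x
      rw [hasDerivAt_pi]
      intro y
      convert! hasDerivAt_prodKernel t x y using 1
      rw [Matrix.mul_apply, ← sum_mul_forwardRate]
      rfl
    exact this
  have hE : ∀ t : ℝ, HasDerivAt (fun t : ℝ => NormedSpace.exp (t • (-R)))
      (-R * NormedSpace.exp (t • (-R))) t := fun t => hasDerivAt_exp_smul_const' (-R) t
  have hF : ∀ t : ℝ, HasDerivAt (fun t : ℝ => Matrix.of (prodKernel t) * NormedSpace.exp (t • (-R)))
      0 t := by
    intro t
    convert! (hP t).mul (hE t) using 1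
    rw [mul_assoc, neg_mul, mul_neg, add_neg_cancel]
  have hc := is_const_of_deriv_eq_zero (fun t => (hF t).differentiableAt) (fun t => (hF t).deriv) t 0
  have h0 : (Matrix.of (prodKernel 0) : Matrix (State d S) (State d S) ℝ) = 1 := by
    ext x y
    simp only [Matrix.of_apply, prodKernel, tokenKernel, neg_zero, Real.exp_zero, sub_self,
      zero_div, add_zero, one_mul, Matrix.one_apply, Finset.prod_ite_zero, Finset.prod_const_one]
    simp [funext_iff]
  simp only [zero_smul, NormedSpace.exp_zero, mul_one, h0] at hc
  have h1 : NormedSpace.exp (t • (-R)) * NormedSpace.exp (t • R) = 1 := by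
    rw [← Matrix.exp_add_of_commute _ _
      (((Commute.refl R).neg_left.smul_left t).smul_right t), smul_neg, neg_add_cancel,
      NormedSpace.exp_zero]
  calc NormedSpace.exp (t • R) = (Matrix.of (prodKernel t) * NormedSpace.exp (t • (-R))) *
        NormedSpace.exp (t • R) := by rw [hc, one_mul]
    _ = _ := by rw [mul_assoc, h1, mul_one]

end

lemma forwardLaw_eq_sum [NeZero S] (q : State d S → ℝ) (t : ℝ) (x : State d S) :
    forwardLaw q t x = ∑ y, q y * prodKernel t y x := by
  rw [forwardLaw, exp_smul_forwardRate]
  rfl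

lemma forwardLaw_add (q : State d S → ℝ) (u h : ℝ) :
    forwardLaw q (u + h) = forwardLaw (forwardLaw q u) h := by
  unfold forwardLaw
  rw [Matrix.vecMul_vecMul, add_smul, Matrix.exp_add_of_commute]
  exact ((Commute.refl _).smul_left u).smul_right h

lemma hasDerivAt_forwardLaw [NeZero S] (q : State d S → ℝ) (t : ℝ) (x : State d S) :
    HasDerivAt (fun t => forwardLaw q t x)
      (∑ i, ((1 / (S : ℝ)) * ∑ b, forwardLaw q t (Function.update x i b) - forwardLaw q t x)) t := by
  simp only [forwardLaw_eq_sum]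
  have := HasDerivAt.fun_sum (u := Finset.univ)
    (fun y _ => (hasDerivAt_prodKernel t y x).const_mul (q y))
  convert! this using 1
  simp only [Finset.mul_sum, mul_sub, Finset.sum_sub_distrib]
  rw [Finset.sum_comm (t := (Finset.univ : Finset (State d S)))]
  congr 1
  · rw [Finset.sum_comm (s := (Finset.univ : Finset (State d S)))]
    refine Finset.sum_congr rfl fun i _ => ?_
    rw [Finset.sum_comm]
    refine Finset.sum_congr rfl fun b _ => Finset.sum_congr rfl fun c _ => by ring

lemma sum_forwardLaw [NeZero S] (q : State d S → ℝ) (t : ℝ) :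
    ∑ x, forwardLaw q t x = ∑ x, q x := by
  simp only [forwardLaw_eq_sum]
  rw [Finset.sum_comm]
  simp only [← Finset.mul_sum, sum_prodKernel, mul_one]

lemma forwardLaw_pos [NeZero S] {q : State d S → ℝ} (hq : q ∈ stdSimplex ℝ (State d S)) {t : ℝ}
    (ht : 0 < t) (x : State d S) : 0 < forwardLaw q t x := by
  rw [forwardLaw_eq_sum]
  have hnn : ∀ y, 0 ≤ q y * prodKernel t y x := fun y =>
    mul_nonneg (hq.1 y) (prodKernel_pos ht _ _).le
  refine lt_of_le_of_ne (Finset.sum_nonneg fun y _ => hnn y) fun h => ?_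
  have h0 := (Finset.sum_eq_zero_iff_of_nonneg fun y _ => hnn y).1 h.symm
  have : ∀ y, q y = 0 := fun y =>
    (mul_eq_zero.1 (h0 y (Finset.mem_univ y))).resolve_right (prodKernel_pos ht _ _).ne'
  have h1 := hq.2
  simp [this] at h1

lemma forwardLaw_mem_stdSimplex [NeZero S] {q : State d S → ℝ}
    (hq : q ∈ stdSimplex ℝ (State d S)) {t : ℝ} (ht : 0 < t) :
    forwardLaw q t ∈ stdSimplex ℝ (State d S) :=
  ⟨fun x => (forwardLaw_pos hq ht x).le, by rw [sum_forwardLaw, hq.2]⟩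

/-! ### Sums over single-token changes -/

/-- Reversibility in combinatorial form: `(x, b) ↦ (update x i b, x i)` is an involution exchanging
the two ends of a move. -/
lemma sum_update_swap (i : Fin d) (F : State d S → State d S → ℝ) :
    ∑ x, ∑ b, F x (Function.update x i b) = ∑ z, ∑ c, F (Function.update z i c) z := by
  rw [← Fintype.sum_prod_type', ← Fintype.sum_prod_type']
  let e : State d S × Fin S → State d S × Fin S := fun p => (Function.update p.1 i p.2, p.1 i)
  have he : Function.Involutive e := fun p => by simp [e]
  exact Fintype.sum_equiv he.toPerm _ _ fun p => by simp [e]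

lemma sum_update_ne_swap (i : Fin d) (F : State d S → State d S → ℝ) :
    ∑ x, ∑ b with b ≠ x i, F x (Function.update x i b) =
      ∑ z, ∑ c with c ≠ z i, F (Function.update z i c) z := by
  have := sum_update_swap i fun x z => if x i ≠ z i then F x z else 0
  simp only [Function.update_self] at this
  simp only [Finset.sum_filter]
  rw [← this]
  simp only [ne_comm]

/-! ### Entropy and its dissipation -/

/-- The log-sum inequality, from the tangent line of `log` at 1 applied to `b i * A / (a i * B)`. It
yields both the monotonicity of the dissipation and the chain rule for relative entropy. -/
lemma log_sum_le {ι : Type*} (s : Finset ι) {a b : ι → ℝ} (ha : ∀ i ∈ s, 0 < a i)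
    (hb : ∀ i ∈ s, 0 < b i) :
    (∑ i ∈ s, a i) * (Real.log (∑ i ∈ s, a i) - Real.log (∑ i ∈ s, b i)) ≤
      ∑ i ∈ s, a i * (Real.log (a i) - Real.log (b i)) := by
  rcases s.eq_empty_or_nonempty with rfl | hs
  · simp
  set A := ∑ i ∈ s, a i with hA
  set B := ∑ i ∈ s, b i with hB
  have hApos : 0 < A := Finset.sum_pos ha hs
  have hBpos : 0 < B := Finset.sum_pos hb hs
  have key : ∀ i ∈ s, a i * (Real.log A - Real.log B) + a i - b i * (A / B) ≤
      a i * (Real.log (a i) - Real.log (b i)) := by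
    intro i hi
    have hai := ha i hi
    have hbi := hb i hi
    have h := Real.log_le_sub_one_of_pos (show 0 < b i * A / (a i * B) by positivity)
    rw [Real.log_div (by positivity) (by positivity), Real.log_mul hbi.ne' hApos.ne',
      Real.log_mul hai.ne' hBpos.ne'] at h
    have h2 := mul_le_mul_of_nonneg_left h hai.le
    have h3 : a i * (b i * A / (a i * B) - 1) = b i * (A / B) - a i := by
      field_simp
    rw [h3] at h2
    linarith
  have := Finset.sum_le_sum key
  rw [Finset.sum_sub_distrib, Finset.sum_add_distrib, ← Finset.sum_mul, ← Finset.sum_mul, ← hA,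
    ← hB, mul_div_cancel₀ _ hBpos.ne'] at this
  linarith

/-- The negative entropy of a mass function. -/
def negEntropy (q : State d S → ℝ) : ℝ := ∑ x, q x * Real.log (q x)

/-- The rate at which the forward process dissipates `negEntropy`. -/
def dissipation (q : State d S → ℝ) : ℝ :=
  (1 / (S : ℝ)) * ∑ i, ∑ x, ∑ b, q x * (Real.log (q x) - Real.log (q (Function.update x i b)))

lemma hasDerivAt_negEntropy [NeZero S] {q : State d S → ℝ} (hq : q ∈ stdSimplex ℝ (State d S))
    {t : ℝ} (ht : 0 < t) :
    HasDerivAt (fun t => negEntropy (forwardLaw q t)) (-dissipation (forwardLaw q t)) t := by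
  have hS : (S : ℝ) ≠ 0 := Nat.cast_ne_zero.2 (NeZero.ne S)
  set p := forwardLaw q t with hp
  have h1 := HasDerivAt.fun_sum (u := Finset.univ) fun x _ =>
    (Real.hasDerivAt_mul_log (forwardLaw_pos hq ht x).ne').comp t (hasDerivAt_forwardLaw q t x)
  convert! h1 using 1
  rw [← hp]
  have h2 : ∀ x, ∑ i, ((1 / (S : ℝ)) * ∑ b, p (Function.update x i b) - p x) =
      ∑ i, (1 / (S : ℝ)) * ∑ b, (p (Function.update x i b) - p x) := by
    intro x
    refine Finset.sum_congr rfl fun i _ => ?_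
    rw [Finset.sum_sub_distrib, mul_sub]
    simp [hS]
  simp only [h2]
  have h4 : ∑ x, (Real.log (p x) + 1) *
        ∑ i, (1 / (S : ℝ)) * ∑ b, (p (Function.update x i b) - p x) =
      (1 / (S : ℝ)) * ∑ i, ∑ x, ∑ b, (Real.log (p x) + 1) * (p (Function.update x i b) - p x) := by
    rw [Finset.sum_comm, Finset.mul_sum]
    refine Finset.sum_congr rfl fun x _ => ?_
    simp only [Finset.mul_sum]
    refine Finset.sum_congr rfl fun i _ => Finset.sum_congr rfl fun b _ => by ring
  rw [h4, dissipation, ← mul_neg, ← Finset.sum_neg_distrib]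
  congr 1
  refine Finset.sum_congr rfl fun i _ => ?_
  -- Summation by parts moves the difference from `p` to `log p`; the constant 1 from the derivative
  -- of `x log x` then cancels.
  have h3 := sum_update_swap i fun x z => (Real.log (p x) + 1) * p z
  simp only [mul_sub, Finset.sum_sub_distrib]
  rw [h3]
  rw [neg_sub]
  simp only [add_mul, one_mul, Finset.sum_add_distrib, mul_comm (Real.log _)]
  ring

lemma tokenKernel_comm (t : ℝ) (a b : Fin S) : tokenKernel t a b = tokenKernel t b a := by
  simp only [tokenKernel, eq_comm]

lemma prodKernel_comm (t : ℝ) (x y : State d S) : prodKernel t x y = prodKernel t y x := by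
  simp only [prodKernel, tokenKernel_comm t (x _)]

/-- The token kernel sees only whether two tokens agree, so it is invariant under addition mod `S`,
and the forward law is an average of translates of `q`. -/
lemma forwardLaw_eq_convolution [NeZero S] (q : State d S → ℝ) (t : ℝ) (x : State d S) :
    forwardLaw q t x = ∑ g, q (x + g) * prodKernel t g 0 := by
  rw [forwardLaw_eq_sum]
  symm
  refine Fintype.sum_equiv (Equiv.addLeft x) _ _ fun g => ?_
  simp [prodKernel, tokenKernel]

/-- The dissipation is translation invariant and built from the jointly convex function `a log (a /
b)`, so averaging over translates cannot increase it. -/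
lemma dissipation_forwardLaw_le [NeZero S] {q : State d S → ℝ} (hq : ∀ x, 0 < q x) {h : ℝ}
    (hh : 0 < h) : dissipation (forwardLaw q h) ≤ dissipation q := by
  unfold dissipation
  refine mul_le_mul_of_nonneg_left (Finset.sum_le_sum fun i _ => ?_) (by positivity)
  set F : State d S → Fin S → ℝ := fun x b =>
    q x * (Real.log (q x) - Real.log (q (Function.update x i b))) with hF
  have h1 : ∀ (x : State d S) (b : Fin S), forwardLaw q h x * (Real.log (forwardLaw q h x) -
      Real.log (forwardLaw q h (Function.update x i b))) ≤
      ∑ g : State d S, prodKernel h g 0 * F (x + g) (b + g i) := by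
    intro x b
    rw [forwardLaw_eq_convolution, forwardLaw_eq_convolution]
    refine (log_sum_le _ (fun g _ => mul_pos (hq _) (prodKernel_pos hh _ _))
      (fun g _ => mul_pos (hq _) (prodKernel_pos hh _ _))).trans (le_of_eq ?_)
    refine Finset.sum_congr rfl fun g _ => ?_
    have hu : Function.update x i b + g = Function.update (x + g) i (b + g i) := by
      ext j
      by_cases hj : j = i
      · subst hj; simp
      · simp [hj]
    rw [Real.log_mul (hq _).ne' (prodKernel_pos hh _ _).ne',
      Real.log_mul (hq _).ne' (prodKernel_pos hh _ _).ne', hu, hF]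
    ring
  refine (Finset.sum_le_sum fun x _ => Finset.sum_le_sum fun b _ => h1 x b).trans (le_of_eq ?_)
  calc ∑ x : State d S, ∑ b, ∑ g : State d S, prodKernel h g 0 * F (x + g) (b + g i)
      = ∑ g : State d S, prodKernel h g 0 * ∑ x : State d S, ∑ b, F (x + g) (b + g i) := by
        simp only [Finset.mul_sum]
        rw [Finset.sum_comm_cycle]
    _ = ∑ g : State d S, prodKernel h g 0 * ∑ x : State d S, ∑ b, F x b := by
        refine Finset.sum_congr rfl fun g _ => ?_
        congr 1
        refine Fintype.sum_equiv (Equiv.addRight g) _ _ fun x => ?_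
        exact Fintype.sum_equiv (Equiv.addRight (g i)) _ _ fun b => by simp
    _ = ∑ x : State d S, ∑ b, F x b := by
        rw [← Finset.sum_mul]
        simp only [prodKernel_comm h _ 0, sum_prodKernel, one_mul]

lemma dissipation_antitone [NeZero S] {q : State d S → ℝ} (hq : q ∈ stdSimplex ℝ (State d S))
    {u v : ℝ} (hu : 0 < u) (huv : u ≤ v) :
    dissipation (forwardLaw q v) ≤ dissipation (forwardLaw q u) := by
  rcases huv.eq_or_lt with rfl | h
  · rfl
  · have := dissipation_forwardLaw_le (forwardLaw_pos hq hu) (sub_pos.2 h)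
    rwa [← forwardLaw_add, add_sub_cancel] at this

/-- Convexity of the negative entropy in time: mean value theorem plus monotonicity of its
derivative. -/
lemma negEntropy_sub_bounds [NeZero S] {q : State d S → ℝ} (hq : q ∈ stdSimplex ℝ (State d S))
    {u v : ℝ} (hu : 0 < u) (huv : u < v) :
    (v - u) * dissipation (forwardLaw q v) ≤
        negEntropy (forwardLaw q u) - negEntropy (forwardLaw q v) ∧
      negEntropy (forwardLaw q u) - negEntropy (forwardLaw q v) ≤
        (v - u) * dissipation (forwardLaw q u) := by
  obtain ⟨c, hc, hc'⟩ := exists_hasDerivAt_eq_slope (fun t => negEntropy (forwardLaw q t))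
    (fun t => -dissipation (forwardLaw q t)) huv
    (fun t ht => (hasDerivAt_negEntropy hq (hu.trans_le ht.1)).continuousAt.continuousWithinAt)
    (fun t ht => hasDerivAt_negEntropy hq (hu.trans ht.1))
  have hvu : 0 < v - u := sub_pos.2 huv
  rw [eq_div_iff hvu.ne'] at hc'
  have h1 := dissipation_antitone hq hu hc.1.le
  have h2 := dissipation_antitone hq (hu.trans hc.1) hc.2.le
  constructor <;> nlinarith

lemma negEntropy_nonpos {q : State d S → ℝ} (hq : q ∈ stdSimplex ℝ (State d S)) :
    negEntropy q ≤ 0 := by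
  refine Finset.sum_nonpos fun x _ => mul_nonpos_of_nonneg_of_nonpos (hq.1 x) ?_
  refine Real.log_nonpos (hq.1 x) ?_
  rw [← hq.2]
  exact Finset.single_le_sum (fun y _ => hq.1 y) (Finset.mem_univ x)

lemma neg_log_card_le_negEntropy {q : State d S → ℝ} (hq : q ∈ stdSimplex ℝ (State d S))
    (hpos : ∀ x, 0 < q x) : -(d * Real.log S) ≤ negEntropy q := by
  have := log_sum_le Finset.univ (fun x _ => hpos x) (b := fun _ => 1) (fun _ _ => one_pos)
  rw [hq.2] at this
  simpa [negEntropy] using this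

lemma dissipation_nonneg [NeZero S] {q : State d S → ℝ} (hq : q ∈ stdSimplex ℝ (State d S))
    {t : ℝ} (ht : 0 < t) : 0 ≤ dissipation (forwardLaw q t) := by
  set p := forwardLaw q t
  have hp : ∀ x, 0 < p x := forwardLaw_pos hq ht
  refine mul_nonneg (by positivity) (Finset.sum_nonneg fun i _ => ?_)
  have key : ∀ x b, p x - p (Function.update x i b) ≤
      p x * (Real.log (p x) - Real.log (p (Function.update x i b))) := by
    intro x b
    have h := Real.log_le_sub_one_of_pos (div_pos (hp (Function.update x i b)) (hp x))
    rw [Real.log_div (hp _).ne' (hp _).ne'] at h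
    have h2 := mul_le_mul_of_nonneg_left h (hp x).le
    rw [mul_sub (p x) (_ / _), mul_div_cancel₀ _ (hp x).ne'] at h2
    linarith
  refine le_trans ?_ (Finset.sum_le_sum fun x _ => Finset.sum_le_sum fun b _ => key x b)
  simp only [Finset.sum_sub_distrib]
  rw [sum_update_swap i fun x z => p z, sub_self]

/-- On `[t/2, t]` the entropy changes by at least `t/2` times the dissipation at `t`, yet its whole
range is `d log S`. -/
lemma dissipation_mul_le [NeZero S] {q : State d S → ℝ} (hq : q ∈ stdSimplex ℝ (State d S))
    {t : ℝ} (ht : 0 < t) : t * dissipation (forwardLaw q t) ≤ 2 * (d * Real.log S) := by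
  have h1 := (negEntropy_sub_bounds hq (half_pos ht) (half_lt_self ht)).1
  have h2 := negEntropy_nonpos (forwardLaw_mem_stdSimplex hq (half_pos ht))
  have h3 := neg_log_card_le_negEntropy (forwardLaw_mem_stdSimplex hq ht) (forwardLaw_pos hq ht)
  linarith

lemma sum_prodKernel_mul_apply [NeZero S] (t : ℝ) (y : State d S) (i : Fin d) (φ : Fin S → ℝ) :
    ∑ x, prodKernel t y x * φ (x i) = ∑ b, tokenKernel t (y i) b * φ b := by
  have h1 : ∀ x : State d S, prodKernel t y x * φ (x i) =
      ∏ j, (tokenKernel t (y j) (x j) * if j = i then φ (x j) else 1) := by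
    intro x
    rw [Finset.prod_mul_distrib, Finset.prod_ite_eq']
    simp [prodKernel]
  simp only [h1]
  rw [← Fintype.prod_sum fun j b => tokenKernel t (y j) b * if j = i then φ b else 1,
    Finset.prod_eq_single i]
  · simp
  · intro j _ hj
    simp [hj, sum_tokenKernel]
  · simp

/-- The kernel is a convex combination of a point mass and the uniform law. By convexity of `x log
x`, which vanishes at 0 and 1, only the uniform part contributes. -/
lemma sum_tokenKernel_mul_log_le [NeZero S] {t : ℝ} (ht : 0 ≤ t) (a : Fin S) :
    ∑ b, tokenKernel t a b * Real.log (tokenKernel t a b) ≤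
      -((1 - Real.exp (-t)) * Real.log S) := by
  have hS : (S : ℝ) ≠ 0 := Nat.cast_ne_zero.2 (NeZero.ne S)
  have he : Real.exp (-t) ≤ 1 := Real.exp_le_one_iff.2 (by linarith)
  have key : ∀ b, tokenKernel t a b * Real.log (tokenKernel t a b) ≤
      (1 - Real.exp (-t)) * ((1 / S) * Real.log (1 / S)) := by
    intro b
    have := Real.convexOn_mul_log.2 (x := if a = b then (1 : ℝ) else 0) (y := 1 / (S : ℝ))
      (by simp only [Set.mem_Ici]; split_ifs <;> norm_num) (by simp)
      (Real.exp_pos (-t)).le (sub_nonneg.2 he) (by ring)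
    simp only [smul_eq_mul] at this
    have h0 : (if a = b then (1 : ℝ) else 0) * Real.log (if a = b then (1 : ℝ) else 0) = 0 := by
      split_ifs <;> simp
    rw [h0, mul_zero, zero_add] at this
    rwa [mul_one_div] at this
  refine (Finset.sum_le_sum fun b _ => key b).trans (le_of_eq ?_)
  rw [Finset.sum_const, Finset.card_univ, Fintype.card_fin, nsmul_eq_mul, one_div, Real.log_inv]
  field_simp

/-- By convexity the worst initial law is a point mass, and then the entropy is a sum over
independent tokens. The left side is the relative entropy to the uniform law. -/
lemma negEntropy_forwardLaw_le [NeZero S] {q : State d S → ℝ}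
    (hq : q ∈ stdSimplex ℝ (State d S)) {t : ℝ} (ht : 0 < t) :
    negEntropy (forwardLaw q t) + d * Real.log S ≤ d * Real.log S * Real.exp (-t) := by
  have h1 : negEntropy (forwardLaw q t) ≤
      ∑ x, ∑ y, q y * (prodKernel t y x * Real.log (prodKernel t y x)) := by
    refine Finset.sum_le_sum fun x _ => ?_
    rw [forwardLaw_eq_sum]
    have := Real.convexOn_mul_log.map_sum_le (t := Finset.univ) (w := q)
      (p := fun y => prodKernel t y x) (fun y _ => hq.1 y) hq.2
      (fun y _ => (prodKernel_pos ht y x).le)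
    simpa only [smul_eq_mul] using this
  rw [Finset.sum_comm] at h1
  have h2 : ∀ y : State d S, ∑ x, prodKernel t y x * Real.log (prodKernel t y x) ≤
      -(d * ((1 - Real.exp (-t)) * Real.log S)) := by
    intro y
    have h3 : ∀ x, prodKernel t y x * Real.log (prodKernel t y x) =
        ∑ i, prodKernel t y x * Real.log (tokenKernel t (y i) (x i)) := by
      intro x
      rw [← Finset.mul_sum]
      congr 1
      exact Real.log_prod fun i _ => (tokenKernel_pos ht _ _).ne'
    simp only [h3]
    rw [Finset.sum_comm]
    simp only [fun i => sum_prodKernel_mul_apply t y i fun b => Real.log (tokenKernel t (y i) b)]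
    refine (Finset.sum_le_sum fun i _ => sum_tokenKernel_mul_log_le ht.le (y i)).trans
      (le_of_eq ?_)
    simp
  have h4 : ∑ y, ∑ x, q y * (prodKernel t y x * Real.log (prodKernel t y x)) ≤
      -(d * ((1 - Real.exp (-t)) * Real.log S)) := by
    simp only [← Finset.mul_sum]
    refine (Finset.sum_le_sum fun y _ => mul_le_mul_of_nonneg_left (h2 y) (hq.1 y)).trans
      (le_of_eq ?_)
    rw [← Finset.sum_mul, hq.2, one_mul]
  linarith

/-! ### Evolving all tokens but one -/

/-- The joint mass of the value `b` of token `i` before, and of the values `x j`, `j ≠ i`, of the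
other tokens after running the forward process for time `h` from `q`. -/
def partialLaw (q : State d S → ℝ) (h : ℝ) (i : Fin d) (x : State d S) (b : Fin S) : ℝ :=
  ∑ y with y i = b, q y * ∏ j ∈ Finset.univ.erase i, tokenKernel h (y j) (x j)

lemma partialLaw_nonneg [NeZero S] {q : State d S → ℝ} (hq : ∀ x, 0 ≤ q x) {h : ℝ} (hh : 0 < h)
    (i : Fin d) (x : State d S) (b : Fin S) : 0 ≤ partialLaw q h i x b :=
  Finset.sum_nonneg fun y _ => mul_nonneg (hq y)
    (Finset.prod_nonneg fun _ _ => (tokenKernel_pos hh _ _).le)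

lemma partialLaw_update (q : State d S → ℝ) (h : ℝ) (i : Fin d) (x : State d S) (b c : Fin S) :
    partialLaw q h i (Function.update x i c) b = partialLaw q h i x b := by
  simp only [partialLaw, prod_erase_update]

/-- The joint law of the later state and the earlier value of token `i` is `tokenKernel` times
`partialLaw`. For `b ≠ x i` the first factor is the constant `(1 - e^{-h}) / S`. -/
lemma sum_mul_prodKernel_mul (q : State d S → ℝ) (h : ℝ) (i : Fin d) (x : State d S)
    (φ : Fin S → ℝ) :
    ∑ y, q y * prodKernel h y x * φ (y i) =
      ∑ b, φ b * (tokenKernel h b (x i) * partialLaw q h i x b) := by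
  rw [← Finset.sum_fiberwise (s := Finset.univ) (g := fun y : State d S => y i)]
  refine Finset.sum_congr rfl fun b _ => ?_
  rw [partialLaw, Finset.mul_sum, Finset.mul_sum]
  refine Finset.sum_congr rfl fun y hy => ?_
  rw [prodKernel_eq_mul_erase h y x i, (Finset.mem_filter.1 hy).2]
  ring

lemma forwardLaw_eq_sum_partialLaw [NeZero S] (q : State d S → ℝ) (h : ℝ) (i : Fin d)
    (x : State d S) :
    forwardLaw q h x = ∑ b, tokenKernel h b (x i) * partialLaw q h i x b := by
  have := sum_mul_prodKernel_mul q h i x fun _ => 1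
  simpa [forwardLaw_eq_sum] using this

lemma forwardLaw_eq_partialLaw [NeZero S] (q : State d S → ℝ) (h : ℝ) (i : Fin d)
    (x : State d S) :
    forwardLaw q h x = Real.exp (-h) * partialLaw q h i x (x i) +
      (1 - Real.exp (-h)) / S * ∑ b, partialLaw q h i x b := by
  rw [forwardLaw_eq_sum_partialLaw q h i x]
  simp [tokenKernel, add_mul, Finset.sum_add_distrib, Finset.mul_sum]

lemma sum_partialLaw [NeZero S] (q : State d S → ℝ) (h : ℝ) (i : Fin d) (x : State d S) :
    ∑ b, partialLaw q h i x b = ∑ b, forwardLaw q h (Function.update x i b) := by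
  have hS : (S : ℝ) ≠ 0 := Nat.cast_ne_zero.2 (NeZero.ne S)
  simp only [forwardLaw_eq_partialLaw q h i, partialLaw_update, Function.update_self,
    Finset.sum_add_distrib, ← Finset.mul_sum]
  rw [Finset.sum_const, Finset.card_univ, Fintype.card_fin, nsmul_eq_mul]
  field_simp
  ring

lemma sum_partialLaw_self [NeZero S] {q : State d S → ℝ} (hq : q ∈ stdSimplex ℝ (State d S))
    (h : ℝ) (i : Fin d) : ∑ x, partialLaw q h i x (x i) = 1 := by
  have hS : (S : ℝ) ≠ 0 := Nat.cast_ne_zero.2 (NeZero.ne S)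
  have h1 : ∑ x, forwardLaw q h x = 1 := by rw [sum_forwardLaw, hq.2]
  have h2 := sum_update_swap i fun x z : State d S => partialLaw q h i z (z i)
  simp only [partialLaw_update, Function.update_self] at h2
  rw [Finset.sum_congr rfl fun x _ => forwardLaw_eq_partialLaw q h i x, Finset.sum_add_distrib,
    ← Finset.mul_sum, ← Finset.mul_sum, h2] at h1
  simp only [Finset.sum_const, Finset.card_univ, Fintype.card_fin, nsmul_eq_mul,
    ← Finset.mul_sum] at h1
  field_simp at h1
  linarith

/-- Both sides share the same resampled part of token `i`, which alone dominates the term where the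
token was never resampled; `S / (e^t - 1)` is the ratio of their weights. -/
lemma forwardLaw_update_le [NeZero S] {q : State d S → ℝ} (hq : ∀ x, 0 ≤ q x) {t : ℝ} (ht : 0 < t)
    (x : State d S) (i : Fin d) (a : Fin S) :
    forwardLaw q t (Function.update x i a) ≤ (1 + S / (Real.exp t - 1)) * forwardLaw q t x := by
  have hS : (0 : ℝ) < S := Nat.cast_pos.2 (NeZero.pos S)
  have he : 1 < Real.exp t := Real.one_lt_exp_iff.2 ht
  have he' : 0 < Real.exp t - 1 := by linarith
  rw [forwardLaw_eq_partialLaw q t i, forwardLaw_eq_partialLaw q t i x]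
  simp only [partialLaw_update, Function.update_self]
  set G := ∑ b, partialLaw q t i x b with hG
  have h1 : partialLaw q t i x a ≤ G :=
    Finset.single_le_sum (fun b _ => partialLaw_nonneg hq ht i x b) (Finset.mem_univ a)
  have h2 : 0 ≤ partialLaw q t i x (x i) := partialLaw_nonneg hq ht i x _
  have h3 : (1 + S / (Real.exp t - 1)) * ((1 - Real.exp (-t)) / S * G) =
      (1 - Real.exp (-t)) / S * G + Real.exp (-t) * G := by
    rw [Real.exp_neg]
    field_simp
  have h4 : 0 ≤ (1 + S / (Real.exp t - 1)) * (Real.exp (-t) * partialLaw q t i x (x i)) := by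
    positivity
  have h5 := mul_le_mul_of_nonneg_left h1 (Real.exp_pos (-t)).le
  rw [mul_add]
  linarith

lemma sum_forwardLaw_update_le [NeZero S] {q : State d S → ℝ} (hq : ∀ x, 0 ≤ q x) {t : ℝ}
    (ht : 0 < t) (x : State d S) (i : Fin d) :
    (1 - Real.exp (-t)) / S * ∑ b, forwardLaw q t (Function.update x i b) ≤ forwardLaw q t x := by
  rw [forwardLaw_eq_partialLaw q t i x, sum_partialLaw]
  have h2 : 0 ≤ partialLaw q t i x (x i) := partialLaw_nonneg hq ht i x _
  have : 0 ≤ Real.exp (-t) * partialLaw q t i x (x i) := by positivity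
  linarith

/-- Overwriting token `i` is a bijection between the two fibres that leaves the transition factors
of the other tokens unchanged. -/
lemma partialLaw_le_mul [NeZero S] {q : State d S → ℝ} {ρ : ℝ} {i : Fin d}
    (hρ : ∀ y c, q y ≤ ρ * q (Function.update y i c)) {h : ℝ} (hh : 0 < h)
    (x : State d S) (b c : Fin S) : partialLaw q h i x b ≤ ρ * partialLaw q h i x c := by
  have : partialLaw q h i x c = ∑ y with y i = b, q (Function.update y i c) *
      ∏ j ∈ Finset.univ.erase i, tokenKernel h (y j) (x j) := by
    unfold partialLaw
    symm
    refine Finset.sum_nbij' (fun y => Function.update y i c) (fun y => Function.update y i b)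
      (by simp) (by simp) ?_ ?_ ?_
    · intro y hy
      simp [← (Finset.mem_filter.1 hy).2]
    · intro y hy
      simp [← (Finset.mem_filter.1 hy).2]
    · intro y _
      congr 1
      refine Finset.prod_congr rfl fun j hj => ?_
      rw [Function.update_of_ne (Finset.ne_of_mem_erase hj)]
  rw [this, Finset.mul_sum]
  refine Finset.sum_le_sum fun y _ => ?_
  rw [← mul_assoc]
  exact mul_le_mul_of_nonneg_right (hρ y c)
    (Finset.prod_nonneg fun _ _ => (tokenKernel_pos hh _ _).le)

lemma partialLaw_le_mul_forwardLaw [NeZero S] {q : State d S → ℝ} {ρ : ℝ} {i : Fin d}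
    (hρ : ∀ y c, q y ≤ ρ * q (Function.update y i c)) {h : ℝ} (hh : 0 < h)
    (x : State d S) (b : Fin S) : partialLaw q h i x b ≤ ρ * forwardLaw q h x := by
  have h1 : ∑ c, tokenKernel h c (x i) = 1 := by
    simp only [tokenKernel_comm h _ (x i), sum_tokenKernel]
  rw [forwardLaw_eq_sum_partialLaw q h i x, Finset.mul_sum]
  calc partialLaw q h i x b = ∑ c, tokenKernel h c (x i) * partialLaw q h i x b := by
        rw [← Finset.sum_mul, h1, one_mul]
    _ ≤ _ := by
        refine Finset.sum_le_sum fun c _ => ?_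
        rw [mul_left_comm]
        exact mul_le_mul_of_nonneg_left (partialLaw_le_mul hρ hh x b c) (tokenKernel_pos hh _ _).le

/-! ### Elementary estimates -/

lemma one_sub_exp_neg_le (h : ℝ) : 1 - Real.exp (-h) ≤ h := by
  have := Real.add_one_le_exp (-h)
  linarith

lemma exp_neg_le_quadratic {h : ℝ} (hh : 0 ≤ h) : Real.exp (-h) ≤ 1 - h + h ^ 2 / 2 := by
  have h1 := Real.quadratic_le_exp_of_nonneg hh
  rw [Real.exp_neg, inv_le_iff_one_le_mul₀ (Real.exp_pos h)]
  have h2 : 0 ≤ 1 - h + h ^ 2 / 2 := by nlinarith [sq_nonneg (h - 1)]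
  nlinarith [mul_le_mul_of_nonneg_left h1 h2, sq_nonneg (h ^ 2)]

lemma half_min_le_one_sub_exp_neg {t : ℝ} (ht : 0 ≤ t) :
    min 1 t / 2 ≤ 1 - Real.exp (-t) := by
  have h0 : 0 ≤ min 1 t := le_min zero_le_one ht
  have h1 := exp_neg_le_quadratic h0
  have h2 : Real.exp (-t) ≤ Real.exp (-min 1 t) :=
    Real.exp_le_exp.2 (neg_le_neg (min_le_right _ _))
  nlinarith [min_le_left 1 t]

/-- With `s = r e^l` this is `l + |l| ≤ e^l`. It lets the loss itself control `|log s|`, so that no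
factor `log M` is paid for it. -/
lemma abs_log_mul_le {r s : ℝ} (hr : 0 < r) (hs : 0 < s) :
    r * |Real.log (s / r)| - r ≤ s - r - r * Real.log (s / r) := by
  set l := Real.log (s / r)
  have hsr : s = r * Real.exp l := by
    rw [Real.exp_log (div_pos hs hr), mul_div_cancel₀ _ hr.ne']
  have key : l + |l| ≤ Real.exp l := by
    rcases le_total l 0 with h | h
    · rw [abs_of_nonpos h, add_neg_cancel]; exact (Real.exp_pos l).le
    · rw [abs_of_nonneg h]
      nlinarith [Real.quadratic_le_exp_of_nonneg h, sq_nonneg (l - 1)]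
  rw [hsr]
  nlinarith [mul_le_mul_of_nonneg_left key hr.le]

lemma score_loss_nonneg {r s : ℝ} (hr : 0 < r) (hs : 0 < s) :
    0 ≤ s - r - r * Real.log (s / r) := by
  have h := Real.log_le_sub_one_of_pos (div_pos hs hr)
  have h2 := mul_le_mul_of_nonneg_left h hr.le
  rw [mul_sub, mul_div_cancel₀ _ hr.ne'] at h2
  linarith

/-! ### One step of the sampler -/

/-- The total rate `∑ i, ∑ a, R̂(x, x with i-th token a)`. -/
def totalRate (s : State d S → State d S → ℝ) (x : State d S) : ℝ :=
  (1 / (S : ℝ)) * ∑ i, ∑ a with a ≠ x i, s (Function.update x i a) x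

/-- The probability that in a `τ`-leaping step from `x` exactly those Poisson variables which turn
`x` into `y` are equal to one, and the others vanish. -/
def leapKernel (s : State d S → State d S → ℝ) (h : ℝ) (x y : State d S) : ℝ :=
  (∏ i, if y i = x i then 1 else h * s (Function.update x i (y i)) x / S) *
    Real.exp (-(h * totalRate s x))

/-- The sum of `f z x` over pairs of states that differ in exactly one token, divided by `S`. -/
def edgeSum (f : State d S → State d S → ℝ) : ℝ :=
  (1 / (S : ℝ)) * ∑ i, ∑ x, ∑ a with a ≠ x i, f (Function.update x i a) x

lemma edgeSum_congr {f g : State d S → State d S → ℝ} (h : ∀ z x, z ≠ x → f z x = g z x) :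
    edgeSum f = edgeSum g := by
  unfold edgeSum
  congr 1
  refine Finset.sum_congr rfl fun i _ => Finset.sum_congr rfl fun x _ =>
    Finset.sum_congr rfl fun a ha => h _ _ ?_
  simpa [Function.update_eq_self_iff] using ha

lemma edgeSum_mono {f g : State d S → State d S → ℝ}
    (h : ∀ x i a, a ≠ x i → f (Function.update x i a) x ≤ g (Function.update x i a) x) :
    edgeSum f ≤ edgeSum g := by
  unfold edgeSum
  refine mul_le_mul_of_nonneg_left ?_ (by positivity)
  exact Finset.sum_le_sum fun i _ => Finset.sum_le_sum fun x _ => Finset.sum_le_sum fun a ha =>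
    h _ _ _ (Finset.mem_filter.1 ha).2

lemma edgeSum_add (f g : State d S → State d S → ℝ) :
    edgeSum (fun z x => f z x + g z x) = edgeSum f + edgeSum g := by
  simp only [edgeSum, Finset.sum_add_distrib, mul_add]

lemma edgeSum_sub (f g : State d S → State d S → ℝ) :
    edgeSum (fun z x => f z x - g z x) = edgeSum f - edgeSum g := by
  simp only [edgeSum, Finset.sum_sub_distrib, mul_sub]

lemma edgeSum_const_mul (c : ℝ) (f : State d S → State d S → ℝ) :
    edgeSum (fun z x => c * f z x) = c * edgeSum f := by
  simp only [edgeSum, ← Finset.mul_sum, mul_left_comm c]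

lemma edgeSum_fst [NeZero S] (f : State d S → ℝ) :
    edgeSum (fun z _ => f z) = (d * (1 - 1 / S)) * ∑ x, f x := by
  have hS : (S : ℝ) ≠ 0 := Nat.cast_ne_zero.2 (NeZero.ne S)
  have hc : ∀ x : Fin S, ((Finset.univ.filter fun a => a ≠ x).card : ℝ) = S - 1 := by
    intro x
    rw [Finset.filter_ne', Finset.card_erase_of_mem (Finset.mem_univ _), Finset.card_univ,
      Fintype.card_fin, Nat.cast_sub (NeZero.pos S), Nat.cast_one]
  unfold edgeSum
  simp only [fun i => sum_update_ne_swap i fun _ z => f z, Finset.sum_const, nsmul_eq_mul, hc,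
    ← Finset.mul_sum, Finset.card_univ, Fintype.card_fin]
  field_simp

lemma edgeSum_mul_snd (p : State d S → ℝ) (s : State d S → State d S → ℝ) :
    edgeSum (fun z x => p x * s z x) = ∑ x, p x * totalRate s x := by
  simp only [edgeSum, totalRate, ← Finset.mul_sum]
  rw [Finset.sum_comm, Finset.mul_sum]
  refine Finset.sum_congr rfl fun x _ => ?_
  rw [← Finset.mul_sum, mul_left_comm]

lemma edgeSum_dissipation (p : State d S → ℝ) :
    edgeSum (fun z x => p z * (Real.log (p z) - Real.log (p x))) = dissipation p := by
  unfold edgeSum dissipation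
  congr 1
  refine Finset.sum_congr rfl fun i _ => ?_
  rw [sum_update_swap i fun x z => p x * (Real.log (p x) - Real.log (p z))]
  refine Finset.sum_congr rfl fun x _ => ?_
  rw [Finset.sum_filter]
  refine Finset.sum_congr rfl fun a _ => ?_
  split_ifs with h
  · rfl
  · rw [not_not] at h
    simp [h]

/-! ### Expanding the score-entropy loss and controlling the logarithm of the score -/

section score

variable {q : State d S → ℝ} {t : ℝ} {s : State d S → State d S → ℝ}

lemma scoreEntropy_eq_edgeSum (q : State d S → ℝ) (t : ℝ) (s : State d S → State d S → ℝ) :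
    scoreEntropy q t s = edgeSum fun z x => forwardLaw q t x *
      (s z x - forwardLaw q t z / forwardLaw q t x - forwardLaw q t z / forwardLaw q t x *
        Real.log (s z x / (forwardLaw q t z / forwardLaw q t x))) := by
  rw [edgeSum_mul_snd (s := fun z x => s z x - forwardLaw q t z / forwardLaw q t x -
    forwardLaw q t z / forwardLaw q t x *
        Real.log (s z x / (forwardLaw q t z / forwardLaw q t x)))]
  refine Finset.sum_congr rfl fun x _ => ?_
  rw [sum_ne_forwardRate_mul, totalRate]

lemma scoreEntropy_nonneg [NeZero S] (hq : q ∈ stdSimplex ℝ (State d S)) (ht : 0 < t)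
    (hs : ∀ z x, z ≠ x → 0 < s z x) : 0 ≤ scoreEntropy q t s := by
  rw [scoreEntropy_eq_edgeSum]
  have : edgeSum (fun _ _ : State d S => (0 : ℝ)) = 0 := by simp [edgeSum]
  rw [← this]
  refine edgeSum_mono fun x i a ha => mul_nonneg (forwardLaw_pos hq ht x).le ?_
  exact score_loss_nonneg (div_pos (forwardLaw_pos hq ht _) (forwardLaw_pos hq ht _))
    (hs _ _ (by simpa [Function.update_eq_self_iff] using ha))

/-- Among the terms free of `s`, the part `r log r` of the loss at the true ratio `r` sums to the
entropy dissipation. This links the loss to the entropy increments of `stepError_le`. -/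
lemma scoreEntropy_eq [NeZero S] (hq : q ∈ stdSimplex ℝ (State d S)) (ht : 0 < t)
    (hs : ∀ z x, z ≠ x → 0 < s z x) :
    scoreEntropy q t s = ∑ x, forwardLaw q t x * totalRate s x - d * (1 - 1 / S) -
      edgeSum (fun z x => forwardLaw q t z * Real.log (s z x)) +
        dissipation (forwardLaw q t) := by
  have hp := forwardLaw_pos hq ht
  have h1 := edgeSum_fst (forwardLaw q t)
  rw [sum_forwardLaw, hq.2, mul_one] at h1
  rw [scoreEntropy_eq_edgeSum, ← edgeSum_mul_snd, ← h1, ← edgeSum_dissipation, ← edgeSum_sub,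
    ← edgeSum_sub, ← edgeSum_add]
  refine edgeSum_congr fun z x hzx => ?_
  have hx := hp x
  have hz := hp z
  rw [Real.log_div (hs z x hzx).ne' (div_pos hz hx).ne', Real.log_div hz.ne' hx.ne']
  field_simp
  ring

lemma abs_log_forwardLaw_sub_le [NeZero S] (hq : q ∈ stdSimplex ℝ (State d S)) (ht : 0 < t)
    (x : State d S) (i : Fin d) (a : Fin S) :
    |Real.log (forwardLaw q t (Function.update x i a)) - Real.log (forwardLaw q t x)| ≤
      Real.log (1 + S / t) := by
  have hp := forwardLaw_pos hq ht
  have hS : (0 : ℝ) < S := Nat.cast_pos.2 (NeZero.pos S)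
  have hle : 1 + S / (Real.exp t - 1) ≤ 1 + S / t := by
    have := Real.add_one_le_exp t
    gcongr
    linarith
  have h0 : 0 < Real.exp t - 1 := by linarith [Real.one_lt_exp_iff.2 ht]
  have key : ∀ y c, Real.log (forwardLaw q t (Function.update y i c)) ≤
      Real.log (1 + S / t) + Real.log (forwardLaw q t y) := by
    intro y c
    rw [← Real.log_mul (by positivity) (hp y).ne']
    refine Real.log_le_log (hp _) ((forwardLaw_update_le hq.1 ht y i c).trans ?_)
    exact mul_le_mul_of_nonneg_right hle (hp y).le
  rw [abs_le]
  constructor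
  · have := key (Function.update x i a) (x i)
    rw [Function.update_idem, Function.update_eq_self] at this
    linarith
  · have := key x a
    linarith

lemma edgeSum_abs_log_le [NeZero S] (hq : q ∈ stdSimplex ℝ (State d S)) (ht : 0 < t)
    (hs : ∀ z x, z ≠ x → 0 < s z x) :
    edgeSum (fun z x => forwardLaw q t z * |Real.log (s z x)|) ≤
      scoreEntropy q t s + d * (1 + Real.log (1 + S / t)) := by
  have hp := forwardLaw_pos hq ht
  have hS : (0 : ℝ) < S := Nat.cast_pos.2 (NeZero.pos S)
  have hlog : 0 ≤ Real.log (1 + S / t) := Real.log_nonneg (by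
    have : 0 ≤ S / t := by positivity
    linarith)
  have h1 := edgeSum_fst (forwardLaw q t)
  rw [sum_forwardLaw, hq.2, mul_one] at h1
  have h2 : edgeSum (fun z _ => (1 + Real.log (1 + S / t)) * forwardLaw q t z) ≤
      d * (1 + Real.log (1 + S / t)) := by
    rw [edgeSum_const_mul, h1]
    have h3 : (d : ℝ) * (1 - 1 / S) ≤ d := by
      have : 0 ≤ (d : ℝ) * (1 / S) := by positivity
      linarith
    nlinarith
  refine le_trans ?_ (add_le_add_right h2 _)
  rw [scoreEntropy_eq_edgeSum, ← edgeSum_add]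
  refine edgeSum_mono fun x i a ha => ?_
  set z := Function.update x i a with hz
  have hzx : z ≠ x := by simpa [hz, Function.update_eq_self_iff] using ha
  have hr : 0 < forwardLaw q t z / forwardLaw q t x := div_pos (hp z) (hp x)
  have h4 := mul_le_mul_of_nonneg_left (abs_log_mul_le hr (hs z x hzx)) (hp x).le
  have h5 : forwardLaw q t x * (forwardLaw q t z / forwardLaw q t x) = forwardLaw q t z :=
    mul_div_cancel₀ _ (hp x).ne'
  have h6 : |Real.log (s z x)| ≤ |Real.log (s z x / (forwardLaw q t z / forwardLaw q t x))| +
      Real.log (1 + S / t) := by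
    have h7 := abs_log_forwardLaw_sub_le hq ht x i a
    rw [← hz, ← Real.log_div (hp z).ne' (hp x).ne'] at h7
    have h8 : Real.log (s z x) = Real.log (s z x / (forwardLaw q t z / forwardLaw q t x)) +
        Real.log (forwardLaw q t z / forwardLaw q t x) := by
      rw [Real.log_div (hs z x hzx).ne' hr.ne', sub_add_cancel]
    rw [h8]
    exact (abs_add_le _ _).trans (add_le_add le_rfl h7)
  rw [mul_sub, ← mul_assoc, h5] at h4
  nlinarith [mul_le_mul_of_nonneg_left h6 (hp z).le]

end score

/-! ### Relative entropy of one reverse step -/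

/-- The conditional relative entropy, over a time interval of length `h`, of the time reversal of
the forward process started from `p` with respect to `leapKernel`. -/
def stepError (p : State d S → ℝ) (h : ℝ) (s : State d S → State d S → ℝ) : ℝ :=
  ∑ x, ∑ y, p y * prodKernel h y x *
    (Real.log (p y * prodKernel h y x) - Real.log (forwardLaw p h x * leapKernel s h x y))

/-- The expected sum of `log s` over the tokens that change during a time interval of length `h`. -/
def jumpLogSum (p : State d S → ℝ) (h : ℝ) (s : State d S → State d S → ℝ) : ℝ :=
  (1 / (S : ℝ)) * ∑ i, ∑ x, ∑ a with a ≠ x i,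
    (1 - Real.exp (-h)) * partialLaw p h i x a * Real.log (s (Function.update x i a) x)

lemma leapKernel_pos [NeZero S] {s : State d S → State d S → ℝ} (hs : ∀ z x, z ≠ x → 0 < s z x)
    {h : ℝ} (hh : 0 < h) (x y : State d S) : 0 < leapKernel s h x y := by
  have hS : (0 : ℝ) < S := Nat.cast_pos.2 (NeZero.pos S)
  refine mul_pos (Finset.prod_pos fun i _ => ?_) (Real.exp_pos _)
  split_ifs with hi
  · exact one_pos
  · have := hs (Function.update x i (y i)) x (by simpa [Function.update_eq_self_iff] using hi)
    positivity

lemma log_leapKernel [NeZero S] {s : State d S → State d S → ℝ} (hs : ∀ z x, z ≠ x → 0 < s z x)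
    {h : ℝ} (hh : 0 < h) (x y : State d S) :
    Real.log (leapKernel s h x y) =
      (∑ i, if y i = x i then 0 else Real.log (h * s (Function.update x i (y i)) x / S)) -
        h * totalRate s x := by
  have hS : (0 : ℝ) < S := Nat.cast_pos.2 (NeZero.pos S)
  have hne : ∀ i ∈ Finset.univ, (if y i = x i then 1 else
      h * s (Function.update x i (y i)) x / S) ≠ 0 := by
    intro i _
    split_ifs with hi
    · exact one_ne_zero
    · have := hs (Function.update x i (y i)) x (by simpa [Function.update_eq_self_iff] using hi)
      positivity
  rw [leapKernel, Real.log_mul (Finset.prod_ne_zero_iff.2 hne) (Real.exp_pos _).ne', Real.log_exp,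
    Real.log_prod hne, sub_eq_add_neg]
  congr 1
  refine Finset.sum_congr rfl fun i _ => ?_
  split_ifs <;> simp

lemma tokenKernel_self (h : ℝ) (a b : Fin S) : tokenKernel h a a = tokenKernel h b b := by
  simp [tokenKernel]

lemma stepError_le [NeZero S] {p : State d S → ℝ} (hp : p ∈ stdSimplex ℝ (State d S))
    (hpos : ∀ x, 0 < p x) {s : State d S → State d S → ℝ} (hs : ∀ z x, z ≠ x → 0 < s z x)
    {h : ℝ} (hh : 0 < h) :
    stepError p h s ≤ negEntropy p - negEntropy (forwardLaw p h) +
      h * ∑ x, forwardLaw p h x * totalRate s x +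
      d * (tokenKernel h (0 : Fin S) 0 * Real.log (tokenKernel h (0 : Fin S) 0)) -
      jumpLogSum p h s := by
  have hS : (0 : ℝ) < S := Nat.cast_pos.2 (NeZero.pos S)
  set p' := forwardLaw p h with hp'
  have hp'pos : ∀ x, 0 < p' x := forwardLaw_pos hp hh
  set π := tokenKernel h (0 : Fin S) 0 with hπ
  have hw : 0 < 1 - Real.exp (-h) := by
    have : Real.exp (-h) < 1 := Real.exp_lt_one_iff.2 (by linarith)
    linarith
  -- The contribution of one token to the log-ratio of the kernels. For a changed token the ratio is
  -- `(1 - e^{-h}) / (h s)`, and `1 - e^{-h} ≤ h` leaves at most `-log s`.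
  set ψ : Fin d → State d S → Fin S → ℝ := fun i x b =>
    if b = x i then Real.log π else -Real.log (s (Function.update x i b) x) with hψ
  have h1 : ∀ x y, Real.log (p y * prodKernel h y x) - Real.log (p' x * leapKernel s h x y) ≤
      Real.log (p y) - Real.log (p' x) + h * totalRate s x + ∑ i, ψ i x (y i) := by
    intro x y
    rw [Real.log_mul (hpos y).ne' (prodKernel_pos hh y x).ne',
      Real.log_mul (hp'pos x).ne' (leapKernel_pos hs hh x y).ne', log_leapKernel hs hh,
      prodKernel, Real.log_prod fun i _ => (tokenKernel_pos hh _ _).ne']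
    have : ∑ i, Real.log (tokenKernel h (y i) (x i)) ≤ ∑ i, ψ i x (y i) +
        ∑ i, if y i = x i then 0 else Real.log (h * s (Function.update x i (y i)) x / S) := by
      rw [← Finset.sum_add_distrib]
      refine Finset.sum_le_sum fun i _ => ?_
      simp only [hψ]
      split_ifs with hi
      · rw [hi, hπ, tokenKernel_self h (x i) 0, add_zero]
      · have hsp := hs (Function.update x i (y i)) x
          (by simpa [Function.update_eq_self_iff] using hi)
        have h2 : tokenKernel h (y i) (x i) = (1 - Real.exp (-h)) / S := by
          simp [tokenKernel, hi]
        rw [h2, Real.log_div hw.ne' hS.ne', Real.log_div (by positivity) hS.ne',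
          Real.log_mul hh.ne' hsp.ne']
        have := Real.log_le_log hw (one_sub_exp_neg_le h)
        linarith
    linarith
  have hA : ∀ x y, 0 ≤ p y * prodKernel h y x := fun x y =>
    (mul_pos (hpos y) (prodKernel_pos hh y x)).le
  have h3 : stepError p h s ≤ ∑ x, ∑ y, p y * prodKernel h y x *
      (Real.log (p y) - Real.log (p' x) + h * totalRate s x + ∑ i, ψ i x (y i)) :=
    Finset.sum_le_sum fun x _ => Finset.sum_le_sum fun y _ =>
      mul_le_mul_of_nonneg_left (h1 x y) (hA x y)
  refine h3.trans (le_of_eq ?_)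
  have hsplit : ∑ x, ∑ y, p y * prodKernel h y x *
      (Real.log (p y) - Real.log (p' x) + h * totalRate s x + ∑ i, ψ i x (y i)) =
      ∑ x, ∑ y, p y * prodKernel h y x * Real.log (p y) -
      ∑ x, ∑ y, p y * prodKernel h y x * Real.log (p' x) +
      ∑ x, ∑ y, p y * prodKernel h y x * (h * totalRate s x) +
      ∑ x, ∑ y, p y * prodKernel h y x * ∑ i, ψ i x (y i) := by
    simp only [mul_add, mul_sub, Finset.sum_add_distrib, Finset.sum_sub_distrib]
  have hrow : ∀ x, ∑ y, p y * prodKernel h y x = p' x := fun x => (forwardLaw_eq_sum p h x).symm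
  have e1 : ∑ x, ∑ y, p y * prodKernel h y x * Real.log (p y) = negEntropy p := by
    rw [Finset.sum_comm]
    refine Finset.sum_congr rfl fun y _ => ?_
    rw [← Finset.sum_mul, ← Finset.mul_sum, sum_prodKernel, mul_one]
  have e2 : ∑ x, ∑ y, p y * prodKernel h y x * Real.log (p' x) = negEntropy p' := by
    refine Finset.sum_congr rfl fun x _ => ?_
    rw [← Finset.sum_mul, hrow]
  have e3 : ∑ x, ∑ y, p y * prodKernel h y x * (h * totalRate s x) =
      h * ∑ x, p' x * totalRate s x := by
    rw [Finset.mul_sum]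
    refine Finset.sum_congr rfl fun x _ => ?_
    rw [← Finset.sum_mul, hrow, mul_left_comm]
  have e4 : ∑ x, ∑ y, p y * prodKernel h y x * ∑ i, ψ i x (y i) =
      d * (π * Real.log π) - jumpLogSum p h s := by
    have e5 : ∀ x i, ∑ y, p y * prodKernel h y x * ψ i x (y i) =
        π * Real.log π * partialLaw p h i x (x i) - (1 / (S : ℝ)) * ∑ a with a ≠ x i,
          (1 - Real.exp (-h)) * partialLaw p h i x a * Real.log (s (Function.update x i a) x) := by
      intro x i
      rw [sum_mul_prodKernel_mul p h i x (ψ i x), ← Finset.add_sum_erase _ _ (Finset.mem_univ (x i)),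
        ← Finset.filter_ne', Finset.mul_sum, sub_eq_add_neg, ← Finset.sum_neg_distrib]
      congr 1
      · simp only [hψ, if_true, hπ, tokenKernel_self h (x i) 0]
        ring
      · refine Finset.sum_congr rfl fun a ha => ?_
        have ha' : a ≠ x i := (Finset.mem_filter.1 ha).2
        simp only [hψ, if_neg ha', tokenKernel]
        ring
    simp only [Finset.mul_sum (s := (Finset.univ : Finset (Fin d)))]
    have e6 : ∀ x, ∑ y, ∑ i, p y * prodKernel h y x * ψ i x (y i) =
        ∑ i, (π * Real.log π * partialLaw p h i x (x i) - (1 / (S : ℝ)) * ∑ a with a ≠ x i,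
          (1 - Real.exp (-h)) * partialLaw p h i x a *
            Real.log (s (Function.update x i a) x)) := by
      intro x
      rw [Finset.sum_comm]
      exact Finset.sum_congr rfl fun i _ => e5 x i
    rw [Finset.sum_congr rfl fun x _ => e6 x, Finset.sum_comm]
    simp only [Finset.sum_sub_distrib, ← Finset.mul_sum, sum_partialLaw_self hp]
    simp [jumpLogSum]
    ring
  rw [hsplit, e1, e2, e3, e4]
  ring

/-- With `c = 1 - 1/S` and `w = 1 - e^{-h}` the holding probability is `1 - c w`, so the left side
is at most `c (h - w) + (c w)² ≤ h²/2 + h²`. -/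
lemma tokenKernel_mul_log_add_le [NeZero S] {h : ℝ} (hh : 0 < h) :
    tokenKernel h (0 : Fin S) 0 * Real.log (tokenKernel h (0 : Fin S) 0) +
      h * (1 - 1 / S) ≤ 3 / 2 * h ^ 2 := by
  set π := tokenKernel h (0 : Fin S) 0 with hπ
  have hS : (1 : ℝ) ≤ S := Nat.one_le_cast.2 (NeZero.pos S)
  have hpos : 0 < π := tokenKernel_pos hh _ _
  have h1 := mul_le_mul_of_nonneg_left (Real.log_le_sub_one_of_pos hpos) hpos.le
  set w := 1 - Real.exp (-h) with hw
  have hc : π = 1 - (1 - 1 / S) * w := by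
    rw [hπ, tokenKernel, hw]
    simp
    ring
  have hw1 : w ≤ h := one_sub_exp_neg_le h
  have hw2 : h - w ≤ h ^ 2 / 2 := by linarith [exp_neg_le_quadratic hh.le]
  have hw0 : 0 ≤ w := by
    have : Real.exp (-h) ≤ 1 := Real.exp_le_one_iff.2 (by linarith)
    linarith
  have hi0 : (0 : ℝ) < 1 / S := by positivity
  have hi1 : (1 : ℝ) / S ≤ 1 := by rw [div_le_one (by linarith)]; exact hS
  set c := 1 - 1 / (S : ℝ) with hcdef
  have hc0 : 0 ≤ c := by linarith
  have hc1 : c ≤ 1 := by linarith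
  rw [hc] at h1 ⊢
  have h2 : c * w ≤ h := by nlinarith
  have h3 : (c * w) ^ 2 ≤ h ^ 2 := by
    have : 0 ≤ c * w := mul_nonneg hc0 hw0
    nlinarith
  have h4 : c * (h - w) ≤ h ^ 2 / 2 := by nlinarith
  nlinarith

/-! ### True law of a token change against its first-order approximation -/

section coefficient

variable {q : State d S → ℝ} {u h κ : ℝ}

lemma abs_jump_coefficient_le_of_le_one [NeZero S] (hq : q ∈ stdSimplex ℝ (State d S)) (hu : 0 < u)
    (hh : 0 < h) (hκ : h ≤ κ * min 1 (u + h)) (h1 : h ≤ 1) (z : State d S) (i : Fin d) :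
    |h * forwardLaw q (u + h) z -
        (1 - Real.exp (-h)) * partialLaw (forwardLaw q u) h i z (z i)| ≤
      6 * h * min 1 κ * forwardLaw q (u + h) z := by
  have hS : (0 : ℝ) < S := Nat.cast_pos.2 (NeZero.pos S)
  have hτ : 0 < u + h := by linarith
  set Q := forwardLaw q (u + h) z with hQ
  have hQpos : 0 < Q := forwardLaw_pos hq hτ z
  set g := partialLaw (forwardLaw q u) h i z (z i) with hg
  have hg0 : 0 ≤ g := partialLaw_nonneg (fun x => (forwardLaw_pos hq hu x).le) hh i z _
  set w := 1 - Real.exp (-h) with hw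
  set G := (∑ b, partialLaw (forwardLaw q u) h i z b) / S with hG
  have hG0 : 0 ≤ G := div_nonneg (Finset.sum_nonneg fun b _ =>
    partialLaw_nonneg (fun x => (forwardLaw_pos hq hu x).le) hh i z b) hS.le
  have e1 : Q = (1 - w) * g + w * G := by
    rw [hQ, forwardLaw_add, forwardLaw_eq_partialLaw _ h i z, hw, hG]
    ring
  set m := min 1 (u + h) with hm
  have hm0 : 0 < m := lt_min one_pos hτ
  have hm1 : h ≤ m := le_min h1 (by linarith)
  set k := min 1 κ with hk
  have hkm : h ≤ k * m := by
    rcases min_choice 1 κ with h2 | h2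
    · rw [hk, h2, one_mul]; exact hm1
    · rw [hk, h2]; exact hκ
  have hGQ : m * G ≤ 2 * Q := by
    have h3 := sum_forwardLaw_update_le hq.1 hτ z i
    rw [forwardLaw_add, ← sum_partialLaw, ← forwardLaw_add, ← hQ, div_mul_eq_mul_div,
      mul_div_assoc, ← hG] at h3
    have h4 := half_min_le_one_sub_exp_neg hτ.le
    have h5 := mul_le_mul_of_nonneg_right h4 hG0
    linarith
  have hw1 : w ≤ h := one_sub_exp_neg_le h
  have hw2 : h - w ≤ h ^ 2 / 2 := by linarith [exp_neg_le_quadratic hh.le]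
  have hw0 : 0 ≤ w := by
    have : Real.exp (-h) ≤ 1 := Real.exp_le_one_iff.2 (by linarith)
    linarith
  have hgQ : g ≤ 3 * Q := by
    have h3 : 1 / 3 ≤ 1 - w := by
      have h4 : Real.exp (-1) ≤ Real.exp (-h) := Real.exp_le_exp.2 (by linarith)
      have h5 := Real.exp_neg_one_gt_d9
      linarith
    have h6 := mul_le_mul_of_nonneg_right h3 hg0
    have h7 := mul_nonneg hw0 hG0
    linarith
  have hk0 : 0 ≤ k := by
    by_contra hneg
    push Not at hneg
    nlinarith
  have hkm' : k * m ≤ k := by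
    have : m ≤ 1 := min_le_left _ _
    nlinarith
  -- Here `Q = (1 - w) g + w G` with `G` the mean of `g` over token `i`, so `Q - g = w (G - g)`.
  -- Everything is second order in the step, and the three pieces cost 1, 2 and 3 times `h k Q`.
  have e2 : h * Q - w * g = (h - w) * Q + w ^ 2 * (G - g) := by
    rw [e1]; ring
  have hh2 : h * h ≤ h * k := mul_le_mul_of_nonneg_left (hkm.trans hkm') hh.le
  have hww : w ^ 2 ≤ h * h := by nlinarith
  have b1 : (h - w) * Q ≤ h * k * Q := by
    refine mul_le_mul_of_nonneg_right ?_ hQpos.le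
    nlinarith
  have b2 : w ^ 2 * G ≤ 2 * (h * k * Q) := by
    have h3 : h * h * G ≤ h * k * (m * G) := by
      have := mul_le_mul_of_nonneg_left hkm hh.le
      nlinarith
    have h4 := mul_le_mul_of_nonneg_left hGQ (mul_nonneg hh.le hk0)
    have h5 := mul_le_mul_of_nonneg_right hww hG0
    linarith
  have b3 : w ^ 2 * g ≤ 3 * (h * k * Q) := by
    have h3 := mul_le_mul_of_nonneg_right (hww.trans hh2) hg0
    have h4 := mul_le_mul_of_nonneg_left hgQ (mul_nonneg hh.le hk0)
    linarith
  have b4 : 0 ≤ (h - w) * Q := mul_nonneg (by linarith) hQpos.le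
  have b5 : 0 ≤ w ^ 2 * G := by positivity
  have b6 : 0 ≤ w ^ 2 * g := by positivity
  have b7 : 0 ≤ h * k * Q := by positivity
  rw [e2, abs_le]
  constructor <;> nlinarith

/-- After time `log S` neighbouring probabilities differ by a factor at most `1 + S/(S-1) ≤ 3`,
which needs `S ≥ 2`. No smallness in `κ` is required, since a step longer than 1 forces `κ > 1`. -/
lemma abs_jump_coefficient_le_of_log_le [NeZero S] (hq : q ∈ stdSimplex ℝ (State d S)) (hu : 0 < u)
    (hh : 1 < h) (hS2 : 2 ≤ S) (hlog : Real.log S ≤ u) (z : State d S) (i : Fin d) :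
    |h * forwardLaw q (u + h) z -
        (1 - Real.exp (-h)) * partialLaw (forwardLaw q u) h i z (z i)| ≤
      3 * h * forwardLaw q (u + h) z := by
  have hS : (2 : ℝ) ≤ S := by exact_mod_cast hS2
  have hτ : 0 < u + h := by linarith
  have hexp : (S : ℝ) ≤ Real.exp u := by
    rw [← Real.exp_log (show (0 : ℝ) < S by linarith)]
    exact Real.exp_le_exp.2 hlog
  have hρ : 1 + S / (Real.exp u - 1) ≤ 3 := by
    have : S / (Real.exp u - 1) ≤ 2 := by
      rw [div_le_iff₀ (by linarith)]
      linarith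
    linarith
  have hg := partialLaw_le_mul_forwardLaw (q := forwardLaw q u) (ρ := 3) (i := i) (fun y c => by
      have := forwardLaw_update_le hq.1 hu (Function.update y i c) i (y i)
      rw [Function.update_idem, Function.update_eq_self] at this
      exact this.trans (mul_le_mul_of_nonneg_right hρ (forwardLaw_pos hq hu _).le))
    (by linarith : 0 < h) z (z i)
  rw [← forwardLaw_add] at hg
  have hg0 : 0 ≤ partialLaw (forwardLaw q u) h i z (z i) :=
    partialLaw_nonneg (fun x => (forwardLaw_pos hq hu x).le) (by linarith) i z _
  set Q := forwardLaw q (u + h) z with hQ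
  have hQpos : 0 < Q := forwardLaw_pos hq hτ z
  set g := partialLaw (forwardLaw q u) h i z (z i)
  have hw0 : 0 ≤ 1 - Real.exp (-h) := by
    have : Real.exp (-h) ≤ 1 := Real.exp_le_one_iff.2 (by linarith)
    linarith
  have hw1 : (1 - Real.exp (-h)) * g ≤ g := by
    nlinarith [Real.exp_pos (-h)]
  have hw2 : 0 ≤ (1 - Real.exp (-h)) * g := mul_nonneg hw0 hg0
  rw [abs_le]
  constructor <;> nlinarith

end coefficient

/-- At most `d` tokens change, each contributing at most `K`. This crude bound serves only the long
steps ending before time `log S`. -/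
lemma abs_jumpLogSum_le [NeZero S] {p : State d S → ℝ} (hp : p ∈ stdSimplex ℝ (State d S))
    {s : State d S → State d S → ℝ} {K : ℝ} (hK : 0 ≤ K)
    (hs : ∀ z x, z ≠ x → |Real.log (s z x)| ≤ K) {h : ℝ} (hh : 0 < h) :
    |jumpLogSum p h s| ≤ d * K := by
  have hS : (0 : ℝ) < S := Nat.cast_pos.2 (NeZero.pos S)
  have hw0 : 0 ≤ 1 - Real.exp (-h) := by
    have : Real.exp (-h) ≤ 1 := Real.exp_le_one_iff.2 (by linarith)
    linarith
  have h1 : ∀ i x, |∑ a with a ≠ x i, (1 - Real.exp (-h)) * partialLaw p h i x a *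
      Real.log (s (Function.update x i a) x)| ≤ S * (K * forwardLaw p h x) := by
    intro i x
    refine (Finset.abs_sum_le_sum_abs _ _).trans ?_
    have h2 : ∀ a ∈ Finset.univ.filter (fun a => a ≠ x i), |(1 - Real.exp (-h)) *
        partialLaw p h i x a * Real.log (s (Function.update x i a) x)| ≤
        K * ((1 - Real.exp (-h)) * partialLaw p h i x a) := by
      intro a ha
      have h3 := partialLaw_nonneg hp.1 hh i x a
      rw [abs_mul, abs_of_nonneg (mul_nonneg hw0 h3), mul_comm K]
      refine mul_le_mul_of_nonneg_left (hs _ _ ?_) (mul_nonneg hw0 h3)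
      simpa [Function.update_eq_self_iff] using ha
    refine (Finset.sum_le_sum h2).trans ?_
    refine (Finset.sum_le_sum_of_subset_of_nonneg (Finset.filter_subset _ _) fun a _ _ =>
      mul_nonneg hK (mul_nonneg hw0 (partialLaw_nonneg hp.1 hh i x a))).trans ?_
    rw [← Finset.mul_sum, mul_left_comm, forwardLaw_eq_partialLaw p h i x, ← Finset.mul_sum]
    refine mul_le_mul_of_nonneg_left ?_ hK
    rw [mul_add, div_mul_eq_mul_div, mul_div_cancel₀ _ hS.ne']
    have := mul_nonneg (Real.exp_pos (-h)).le (partialLaw_nonneg hp.1 hh i x (x i))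
    have := mul_nonneg hS.le this
    linarith
  unfold jumpLogSum
  rw [abs_mul, abs_of_pos (by positivity : (0 : ℝ) < 1 / S)]
  calc 1 / (S : ℝ) * |_| ≤ 1 / (S : ℝ) * ∑ _i : Fin d, ∑ x, S * (K * forwardLaw p h x) := by
        refine mul_le_mul_of_nonneg_left ?_ (by positivity)
        refine (Finset.abs_sum_le_sum_abs _ _).trans (Finset.sum_le_sum fun i _ => ?_)
        exact (Finset.abs_sum_le_sum_abs _ _).trans (Finset.sum_le_sum fun x _ => h1 i x)
    _ = d * K := by
        simp only [← Finset.mul_sum, sum_forwardLaw, hp.2]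
        simp
        field_simp

lemma edgeSum_sub_jumpLogSum_le [NeZero S] {q : State d S → ℝ} {u h k : ℝ}
    {s : State d S → State d S → ℝ}
    (hk : 2 ≤ S → ∀ z i, |h * forwardLaw q (u + h) z -
        (1 - Real.exp (-h)) * partialLaw (forwardLaw q u) h i z (z i)| ≤
      k * forwardLaw q (u + h) z) :
    h * edgeSum (fun z x => forwardLaw q (u + h) z * Real.log (s z x)) -
        jumpLogSum (forwardLaw q u) h s ≤
      k * edgeSum (fun z x => forwardLaw q (u + h) z * |Real.log (s z x)|) := by
  unfold edgeSum jumpLogSum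
  rw [mul_left_comm, mul_left_comm k, ← mul_sub]
  refine mul_le_mul_of_nonneg_left ?_ (by positivity)
  simp only [Finset.mul_sum, ← Finset.sum_sub_distrib]
  refine Finset.sum_le_sum fun i _ => Finset.sum_le_sum fun x _ => Finset.sum_le_sum fun a ha => ?_
  -- The edge at hand supplies two distinct token values; for `S = 1` there is nothing to sum.
  have hS2 : 2 ≤ S := by
    have : Nontrivial (Fin S) := ⟨⟨a, x i, (Finset.mem_filter.1 ha).2⟩⟩
    exact Fin.nontrivial_iff_two_le.1 this
  have h1 := hk hS2 (Function.update x i a) i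
  rw [partialLaw_update, Function.update_self] at h1
  set Q := forwardLaw q (u + h) (Function.update x i a)
  set l := Real.log (s (Function.update x i a) x)
  calc h * (Q * l) - (1 - Real.exp (-h)) * partialLaw (forwardLaw q u) h i x a * l
      = (h * Q - (1 - Real.exp (-h)) * partialLaw (forwardLaw q u) h i x a) * l := by ring
    _ ≤ |(h * Q - (1 - Real.exp (-h)) * partialLaw (forwardLaw q u) h i x a)| * |l| := by
        rw [← abs_mul]; exact le_abs_self _
    _ ≤ k * Q * |l| := mul_le_mul_of_nonneg_right h1 (abs_nonneg _)
    _ = k * (Q * |l|) := by ring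

lemma edgeSum_mul_le_abs [NeZero S] {q : State d S → ℝ} (hq : q ∈ stdSimplex ℝ (State d S))
    {t : ℝ} (ht : 0 < t) (s : State d S → State d S → ℝ) :
    edgeSum (fun z x => forwardLaw q t z * Real.log (s z x)) ≤
      edgeSum (fun z x => forwardLaw q t z * |Real.log (s z x)|) :=
  edgeSum_mono fun _ _ _ _ => mul_le_mul_of_nonneg_left (le_abs_self _) (forwardLaw_pos hq ht _).le

/-- The error of one step, from time `u + h` back to time `u`. -/
lemma stepError_forwardLaw_le [NeZero S] {q : State d S → ℝ} (hq : q ∈ stdSimplex ℝ (State d S))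
    {u h κ M : ℝ} (hu : 0 < u) (hh : 0 < h) (hκ : h ≤ κ * min 1 (u + h)) (hM : 1 ≤ M)
    {s : State d S → State d S → ℝ} (hs : ∀ z x, z ≠ x → s z x ∈ Set.Icc M⁻¹ M) :
    stepError (forwardLaw q u) h s ≤ 7 * (h * scoreEntropy q (u + h) s) +
      (negEntropy (forwardLaw q u) - negEntropy (forwardLaw q (u + h)) -
        h * dissipation (forwardLaw q (u + h))) +
      κ * d * (h * (15 / 2 + 6 * Real.log (1 + S / (u + h)))) +
      κ * d * ((min (u + h) (Real.log S + 1) - min u (Real.log S + 1)) * Real.log M) := by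
  have hτ : 0 < u + h := by linarith
  have hMpos : 0 < M := by linarith
  have hs0 : ∀ z x, z ≠ x → 0 < s z x := fun z x hzx =>
    (inv_pos.2 hMpos).trans_le (hs z x hzx).1
  have hlogM : 0 ≤ Real.log M := Real.log_nonneg hM
  have hslog : ∀ z x, z ≠ x → |Real.log (s z x)| ≤ Real.log M := by
    intro z x hzx
    rw [abs_le, ← Real.log_inv]
    exact ⟨Real.log_le_log (inv_pos.2 hMpos) (hs z x hzx).1,
      Real.log_le_log (hs0 z x hzx) (hs z x hzx).2⟩
  have hSpos : (0 : ℝ) < S := Nat.cast_pos.2 (NeZero.pos S)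
  have hlog : 0 ≤ Real.log (1 + S / (u + h)) := Real.log_nonneg (by
    have : 0 ≤ S / (u + h) := by positivity
    linarith)
  have hm : 0 < min 1 (u + h) := lt_min one_pos hτ
  have hm1 : min 1 (u + h) ≤ 1 := min_le_left _ _
  have hκ0 : 0 < κ := by
    by_contra hneg
    push Not at hneg
    nlinarith
  have hhκ : h ≤ κ := by nlinarith
  have hd : (0 : ℝ) ≤ d := Nat.cast_nonneg d
  -- The bound `k ≤ 1` keeps the coefficient of the loss universal, while `k ≤ κ` gives the rate in
  -- the remaining term.
  set k := min 1 κ with hk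
  have hk0 : 0 < k := lt_min one_pos hκ0
  have hk1 : k ≤ 1 := min_le_left _ _
  have hkκ : k ≤ κ := min_le_right _ _
  set L := scoreEntropy q (u + h) s with hL
  have hL0 : 0 ≤ L := scoreEntropy_nonneg hq hτ hs0
  set W := edgeSum (fun z x => forwardLaw q (u + h) z * |Real.log (s z x)|) with hW
  have hWle : W ≤ L + d * (1 + Real.log (1 + S / (u + h))) := edgeSum_abs_log_le hq hτ hs0
  have hW0 : 0 ≤ W := by
    have : edgeSum (fun _ _ : State d S => (0 : ℝ)) = 0 := by simp [edgeSum]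
    rw [← this]
    exact edgeSum_mono fun _ _ _ _ => mul_nonneg (forwardLaw_pos hq hτ _).le (abs_nonneg _)
  have hψ0 : 0 ≤ min (u + h) (Real.log S + 1) - min u (Real.log S + 1) :=
    sub_nonneg.2 (min_le_min_right _ (by linarith))
  have hmain : h * edgeSum (fun z x => forwardLaw q (u + h) z * Real.log (s z x)) -
      jumpLogSum (forwardLaw q u) h s ≤ 6 * h * k * W +
      κ * d * ((min (u + h) (Real.log S + 1) - min u (Real.log S + 1)) * Real.log M) := by
    have hlast : 0 ≤ κ * d *
        ((min (u + h) (Real.log S + 1) - min u (Real.log S + 1)) * Real.log M) := by positivity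
    rcases le_or_gt h 1 with h1 | h1
    · have := edgeSum_sub_jumpLogSum_le (s := s) fun _ z i =>
        abs_jump_coefficient_le_of_le_one hq hu hh hκ h1 z i
      linarith
    · have hk' : k = 1 := min_eq_left (by linarith)
      rw [hk']
      rcases le_or_gt (Real.log S) u with h2 | h2
      · have := edgeSum_sub_jumpLogSum_le (s := s) fun hS2 z i =>
          abs_jump_coefficient_le_of_log_le hq hu h1 hS2 h2 z i
        have h3 : 0 ≤ h * W := by positivity
        linarith
      · have h3 := neg_le_of_abs_le
          (abs_jumpLogSum_le (forwardLaw_mem_stdSimplex hq hu) hlogM hslog hh)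
        have h4 := mul_le_mul_of_nonneg_left (edgeSum_mul_le_abs hq hτ s) hh.le
        have h5 : 0 ≤ h * W := by positivity
        -- A long step ending below `log S` advances the truncated clock `min · (log S + 1)` by at
        -- least 1. Charging `log M` to this clock makes the total cost telescope to at most `log S
        -- + 1` clock units.
        have h6 : 1 ≤ min (u + h) (Real.log S + 1) - min u (Real.log S + 1) := by
          rw [min_eq_left (by linarith : u ≤ Real.log S + 1)]
          rcases min_choice (u + h) (Real.log S + 1) with h7 | h7 <;> rw [h7] <;> linarith
        have h8 : d * Real.log M ≤ κ * d *
            ((min (u + h) (Real.log S + 1) - min u (Real.log S + 1)) * Real.log M) := by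
          have h9 : Real.log M ≤
              (min (u + h) (Real.log S + 1) - min u (Real.log S + 1)) * Real.log M :=
            le_mul_of_one_le_left hlogM h6
          have h10 : (d : ℝ) ≤ κ * d := le_mul_of_one_le_left hd (by linarith)
          exact mul_le_mul h10 h9 hlogM (by positivity)
        linarith
  have hst := stepError_le (forwardLaw_mem_stdSimplex hq hu) (forwardLaw_pos hq hu) hs0 hh
  rw [← forwardLaw_add] at hst
  have hsc := scoreEntropy_eq hq hτ hs0
  have htok := mul_le_mul_of_nonneg_left (tokenKernel_mul_log_add_le (S := S) hh) hd
  have hh2 : d * (3 / 2 * h ^ 2) ≤ κ * d * (h * (3 / 2)) := by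
    have : h ^ 2 ≤ κ * h := by nlinarith
    nlinarith
  have hkW : 6 * h * k * W ≤
      6 * (h * L) + κ * d * (h * (6 + 6 * Real.log (1 + S / (u + h)))) := by
    have h1 : 6 * h * k * W ≤ 6 * h * k * (L + d * (1 + Real.log (1 + S / (u + h)))) :=
      mul_le_mul_of_nonneg_left hWle (by positivity)
    have h2 : h * L * k ≤ h * L := mul_le_of_le_one_right (by positivity) hk1
    have h3 : k * (d * h * (1 + Real.log (1 + S / (u + h)))) ≤
        κ * (d * h * (1 + Real.log (1 + S / (u + h)))) :=
      mul_le_mul_of_nonneg_right hkκ (by positivity)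
    nlinarith
  rw [← hL] at hsc
  have hsc' : h * ∑ x, forwardLaw q (u + h) x * totalRate s x = h * L + d * (h * (1 - 1 / S)) +
      h * edgeSum (fun z x => forwardLaw q (u + h) z * Real.log (s z x)) -
      h * dissipation (forwardLaw q (u + h)) := by
    rw [hsc]; ring
  rw [hsc'] at hst
  rw [mul_add] at htok
  have hsplit : κ * d * (h * (15 / 2 + 6 * Real.log (1 + S / (u + h)))) =
      κ * d * (h * (3 / 2)) + κ * d * (h * (6 + 6 * Real.log (1 + S / (u + h)))) := by ring
  linarith

/-! ### Lower bounds for the law of the sampler -/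

lemma forwardRate_update {x : State d S} {i : Fin d} {a : Fin S} (ha : a ≠ x i) :
    forwardRate d S (Function.update x i a) x = 1 / S := by
  have hne : Function.update x i a ≠ x := by simpa [Function.update_eq_self_iff] using ha
  have h1 : forwardRate d S (Function.update x i a) x = jumpRate (Function.update x i a) x := by
    simp [forwardRate, hne]
  rw [h1, jumpRate_eq_sum hne, Finset.sum_eq_single i, Finset.sum_eq_single (x i)]
  · simp
  · intro b _ hb
    rw [if_neg]
    rw [Function.update_idem, eq_comm, Function.update_eq_self_iff]
    exact hb
  · simp
  · intro j _ hj
    refine Finset.sum_eq_zero fun b _ => if_neg fun h => ?_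
    have := congrFun h i
    rw [Function.update_of_ne (Ne.symm hj), Function.update_self] at this
    exact ha this.symm
  · simp

lemma State.toLattice_injective : Function.Injective (State.toLattice : State d S → Lattice d) := by
  intro x y h
  ext i
  have := congrFun h i
  simpa [State.toLattice] using this

lemma leapKernel_eq_prod [NeZero S] (s : State d S → State d S → ℝ) (h : ℝ) (x y : State d S) :
    leapKernel s h x y = ∏ i, ∏ a, (if a = x i then 1 else
      Real.exp (-(h * s (Function.update x i a) x / S)) *
        if a = y i then h * s (Function.update x i a) x / S else 1) := by
  have h1 : ∀ i, ∏ a, (if a = x i then 1 else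
      Real.exp (-(h * s (Function.update x i a) x / S)) *
        if a = y i then h * s (Function.update x i a) x / S else 1) =
      (if y i = x i then 1 else h * s (Function.update x i (y i)) x / S) *
        Real.exp (-∑ a with a ≠ x i, h * s (Function.update x i a) x / S) := by
    intro i
    have h2 : ∀ a, (if a = x i then 1 else
      Real.exp (-(h * s (Function.update x i a) x / S)) *
        if a = y i then h * s (Function.update x i a) x / S else 1) =
        (if a = y i then (if y i = x i then 1 else h * s (Function.update x i (y i)) x / S)
          else 1) *
        (if a ≠ x i then Real.exp (-(h * s (Function.update x i a) x / S)) else 1) := by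
      intro a
      by_cases ha : a = x i <;> by_cases hb : a = y i
      · simp [ha, ← hb]
      · subst ha
        simp [hb]
      · subst hb
        simp [ha, mul_comm]
      · simp [ha, hb]
    simp only [h2]
    rw [Finset.prod_mul_distrib, Finset.prod_ite_eq', if_pos (Finset.mem_univ _),
      ← Finset.prod_filter, ← Real.exp_sum, Finset.sum_neg_distrib]
  simp only [h1]
  rw [Finset.prod_mul_distrib, ← Real.exp_sum, Finset.sum_neg_distrib, leapKernel, totalRate]
  congr 3
  simp only [Finset.mul_sum]
  refine Finset.sum_congr rfl fun i _ => Finset.sum_congr rfl fun a _ => by ring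

lemma leapKernel_le_tauLeapStep [NeZero S] {s : State d S → State d S → ℝ}
    (hs : ∀ z x, z ≠ x → 0 < s z x) {h : ℝ} (hh : 0 < h) (x y : State d S) :
    ENNReal.ofReal (leapKernel s h x y) ≤ tauLeapStep s h x {y.toLattice} := by
  have hS : (0 : ℝ) < S := Nat.cast_pos.2 (NeZero.pos S)
  -- Variables with `a = x i` multiply a zero displacement, so they are left unconstrained and cost
  -- no probability.
  set B : Fin d × Fin S → Set ℕ := fun ia =>
    if ia.2 = x ia.1 then Set.univ else if ia.2 = y ia.1 then {1} else {0} with hB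
  rw [tauLeapStep, Measure.map_apply (measurable_of_countable _) (measurableSet_singleton _)]
  have hsub : Set.pi Set.univ B ⊆ (fun (n : Fin d × Fin S → ℕ) (i : Fin d) => x.toLattice i +
      ∑ a : Fin S, (((a : ℕ) : ℤ) - x.toLattice i) * (n (i, a) : ℤ)) ⁻¹' {y.toLattice} := by
    intro n hn
    simp only [Set.mem_preimage, Set.mem_singleton_iff]
    funext i
    have hn' : ∀ a, a ≠ x i → n (i, a) = if a = y i then 1 else 0 := by
      intro a ha
      have := hn (i, a) (Set.mem_univ _)
      simp only [hB, if_neg ha] at this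
      split_ifs at this ⊢ <;> simpa using this
    rw [Finset.sum_eq_single (y i)]
    · by_cases hxy : y i = x i
      · simp [State.toLattice, hxy]
      · rw [hn' _ hxy, if_pos rfl]
        simp [State.toLattice]
    · intro a _ ha
      by_cases hax : a = x i
      · simp [State.toLattice, hax]
      · rw [hn' _ hax, if_neg ha]
        simp
    · simp
  refine le_trans ?_ (measure_mono hsub)
  rw [Measure.pi_pi, leapKernel_eq_prod, Fintype.prod_prod_type]
  have hnn : ∀ i a, 0 ≤ (if a = x i then 1 else
      Real.exp (-(h * s (Function.update x i a) x / S)) *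
        if a = y i then h * s (Function.update x i a) x / S else 1) := by
    intro i a
    split_ifs with ha hb
    · exact zero_le_one
    · have := hs (Function.update x i a) x (by simpa [Function.update_eq_self_iff] using ha)
      positivity
    · positivity
  rw [ENNReal.ofReal_prod_of_nonneg fun i _ => Finset.prod_nonneg fun a _ => hnn i a]
  refine Finset.prod_le_prod' fun i _ => ?_
  rw [ENNReal.ofReal_prod_of_nonneg fun a _ => hnn i a]
  refine Finset.prod_le_prod' fun a _ => le_of_eq ?_
  simp only [hB]
  by_cases ha : a = x i
  · simp [ha]
  · have hsp := hs (Function.update x i a) x (by simpa [Function.update_eq_self_iff] using ha)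
    have hr : estRate s x (Function.update x i a) * h = h * s (Function.update x i a) x / S := by
      rw [estRate, forwardRate_update ha]
      ring
    have hr0 : 0 ≤ h * s (Function.update x i a) x / S := by positivity
    rw [if_neg ha, if_neg ha, hr]
    split_ifs with hb <;> rw [poissonMeasure_singleton] <;> simp [hr0]

instance tauLeapStep.isProbabilityMeasure (s : State d S → State d S → ℝ) (h : ℝ) (x : State d S) :
    IsProbabilityMeasure (tauLeapStep s h x) :=
  Measure.isProbabilityMeasure_map (measurable_of_countable _).aemeasurable

lemma tauLeapKernel_apply_toLattice (s : State d S → State d S → ℝ) (h : ℝ)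
    (out : Kernel (Lattice d) (Lattice d)) (x : State d S) :
    tauLeapKernel s h out x.toLattice = tauLeapStep s h x := by
  classical
  have hz : ∃ y : State d S, y.toLattice = x.toLattice := ⟨x, rfl⟩
  have h1 : tauLeapKernel s h out x.toLattice = tauLeapStep s h hz.choose := dif_pos hz
  rw [h1, State.toLattice_injective hz.choose_spec]

instance tauLeapKernel.isMarkovKernel (s : State d S → State d S → ℝ) (h : ℝ)
    (out : Kernel (Lattice d) (Lattice d)) [IsMarkovKernel out] :
    IsMarkovKernel (tauLeapKernel s h out) := by
  classical
  refine ⟨fun z => ?_⟩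
  by_cases hz : ∃ y : State d S, y.toLattice = z
  · obtain ⟨y, rfl⟩ := hz
    rw [tauLeapKernel_apply_toLattice]
    infer_instance
  · have h1 : tauLeapKernel s h out z = out z := dif_neg hz
    rw [h1]
    infer_instance

lemma massMeasure_apply_singleton (q : State d S → ℝ) (x : State d S) :
    massMeasure q {x.toLattice} = ENNReal.ofReal (q x) := by
  unfold massMeasure
  rw [Measure.finsetSum_apply, Finset.sum_eq_single x]
  · simp
  · intro y _ hy
    have : y.toLattice ≠ x.toLattice := fun h => hy (State.toLattice_injective h)
    simp [this]
  · simp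

lemma massMeasure_isProbabilityMeasure {q : State d S → ℝ} (hq : q ∈ stdSimplex ℝ (State d S)) :
    IsProbabilityMeasure (massMeasure q) := by
  refine ⟨?_⟩
  unfold massMeasure
  rw [Measure.finsetSum_apply]
  simp only [Measure.smul_apply, measure_univ, smul_eq_mul, mul_one]
  rw [← ENNReal.ofReal_sum_of_nonneg fun x _ => hq.1 x, hq.2, ENNReal.ofReal_one]

/-- The mass on `[S]^d` of those paths of the sampler that only use the transitions counted by
`leapKernel`. -/
def leapLaw (T : ℝ) (t : ℕ → ℝ) (s : ℝ → State d S → State d S → ℝ) : ℕ → State d S → ℝ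
  | 0 => fun _ => 1 / (S : ℝ) ^ d
  | k + 1 => fun y => ∑ x, leapLaw T t s k x * leapKernel (s (T - t k)) (t (k + 1) - t k) x y

lemma uniform_mem_stdSimplex [NeZero S] :
    (fun _ : State d S => 1 / (S : ℝ) ^ d) ∈ stdSimplex ℝ (State d S) := by
  have hS : (0 : ℝ) < S := Nat.cast_pos.2 (NeZero.pos S)
  refine ⟨fun _ => by positivity, ?_⟩
  simp [hS.ne']

lemma tauLeapLaw_isProbabilityMeasure [NeZero S] (T : ℝ) (t : ℕ → ℝ)
    (s : ℝ → State d S → State d S → ℝ) (out : ℕ → Kernel (Lattice d) (Lattice d))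
    (hout : ∀ k, IsMarkovKernel (out k)) (k : ℕ) :
    IsProbabilityMeasure (tauLeapLaw T t s out k) := by
  induction k with
  | zero => exact massMeasure_isProbabilityMeasure uniform_mem_stdSimplex
  | succ k ih =>
    have := hout k
    unfold tauLeapLaw
    infer_instance

lemma leapLaw_pos [NeZero S] {T : ℝ} {N : ℕ} {t : ℕ → ℝ} {s : ℝ → State d S → State d S → ℝ}
    (ht : ∀ k < N, t k < t (k + 1)) (hs : ∀ k < N, ∀ z x, z ≠ x → 0 < s (T - t k) z x) :
    ∀ k ≤ N, ∀ x, 0 < leapLaw T t s k x := by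
  have hS : (0 : ℝ) < S := Nat.cast_pos.2 (NeZero.pos S)
  intro k
  induction k with
  | zero => intro _ x; simp only [leapLaw]; positivity
  | succ k ih =>
    intro hk y
    simp only [leapLaw]
    exact Finset.sum_pos (fun x _ => mul_pos (ih (by omega) x)
      (leapKernel_pos (hs k hk) (sub_pos.2 (ht k hk)) x y)) ⟨fun _ => 0, Finset.mem_univ _⟩

lemma leapLaw_le_tauLeapLaw [NeZero S] {T : ℝ} {N : ℕ} {t : ℕ → ℝ}
    {s : ℝ → State d S → State d S → ℝ} (out : ℕ → Kernel (Lattice d) (Lattice d))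
    (ht : ∀ k < N, t k < t (k + 1)) (hs : ∀ k < N, ∀ z x, z ≠ x → 0 < s (T - t k) z x) :
    ∀ k ≤ N, ∀ x, ENNReal.ofReal (leapLaw T t s k x) ≤ tauLeapLaw T t s out k {x.toLattice} := by
  classical
  intro k
  induction k with
  | zero =>
    intro _ x
    simp only [leapLaw, tauLeapLaw]
    exact (massMeasure_apply_singleton (fun _ : State d S => 1 / (S : ℝ) ^ d) x).ge
  | succ k ih =>
    intro hk y
    have hh := sub_pos.2 (ht k hk)
    simp only [leapLaw, tauLeapLaw]
    rw [Measure.bind_apply (measurableSet_singleton _) (Kernel.aemeasurable _)]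
    set μ := tauLeapLaw T t s out k
    set K := tauLeapKernel (s (T - t k)) (t (k + 1) - t k) (out k)
    have h1 : ∑ x : State d S, K x.toLattice {y.toLattice} * μ {x.toLattice} ≤
        ∫⁻ z, K z {y.toLattice} ∂μ := by
      refine le_trans ?_ (setLIntegral_le_lintegral
        ((Finset.univ.image (State.toLattice : State d S → Lattice d) : Finset (Lattice d)) :
          Set (Lattice d)) _)
      rw [lintegral_finset, Finset.sum_image fun x _ y _ h => State.toLattice_injective h]
    refine le_trans ?_ h1
    rw [ENNReal.ofReal_sum_of_nonneg fun x _ => mul_nonneg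
      (leapLaw_pos ht hs k (by omega) x).le (leapKernel_pos (hs k hk) hh x y).le]
    refine Finset.sum_le_sum fun x _ => ?_
    rw [ENNReal.ofReal_mul (leapLaw_pos ht hs k (by omega) x).le, mul_comm]
    refine mul_le_mul' ?_ (ih (by omega) x)
    simp only [K]
    rw [tauLeapKernel_apply_toLattice]
    exact leapKernel_le_tauLeapStep (hs k hk) hh x y

/-! ### Relative entropy -/

/-- The relative entropy of mass functions. -/
def relEntropy (p r : State d S → ℝ) : ℝ := ∑ x, p x * (Real.log (p x) - Real.log (r x))

/-- `r` need not have total mass one: it enters only as a lower bound for the atoms of `μ`, through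
monotonicity of `log`. -/
lemma klDiv_massMeasure_le {q r : State d S → ℝ} (hq : q ∈ stdSimplex ℝ (State d S))
    (hqpos : ∀ x, 0 < q x) (hr : ∀ x, 0 < r x) (μ : Measure (Lattice d)) [IsProbabilityMeasure μ]
    (hμ : ∀ x : State d S, ENNReal.ofReal (r x) ≤ μ {x.toLattice}) :
    klDiv (massMeasure q) μ ≤ ENNReal.ofReal (relEntropy q r) := by
  have hprob := massMeasure_isProbabilityMeasure hq
  have hμpos : ∀ x : State d S, 0 < μ {x.toLattice} := fun x =>
    (ENNReal.ofReal_pos.2 (hr x)).trans_le (hμ x)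
  have hac : massMeasure q ≪ μ := by
    intro A hA
    unfold massMeasure
    rw [Measure.finsetSum_apply]
    refine Finset.sum_eq_zero fun x _ => ?_
    have hx : x.toLattice ∉ A := fun hx =>
      (hμpos x).ne' (measure_mono_null (Set.singleton_subset_iff.2 hx) hA)
    simp [hx]
  have hint : ∀ f : Lattice d → ℝ, Integrable f (massMeasure q) := by
    intro f
    unfold massMeasure
    rw [integrable_finsetSum_measure]
    exact fun x _ => (integrable_dirac (by simp)).smul_measure ENNReal.ofReal_ne_top
  have hintegral : ∀ f : Lattice d → ℝ, ∫ z, f z ∂(massMeasure q) = ∑ x, q x * f x.toLattice := by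
    intro f
    have h1 := hint f
    unfold massMeasure at h1 ⊢
    rw [integral_finsetSum_measure (integrable_finsetSum_measure.1 h1)]
    refine Finset.sum_congr rfl fun x _ => ?_
    rw [integral_smul_measure, integral_dirac, ENNReal.toReal_ofReal (hq.1 x), smul_eq_mul]
  rw [klDiv_of_ac_of_integrable hac (hint _)]
  refine ENNReal.ofReal_le_ofReal ?_
  simp only [probReal_univ, add_sub_cancel_right]
  rw [hintegral]
  refine Finset.sum_le_sum fun x _ => mul_le_mul_of_nonneg_left ?_ (hq.1 x)
  have hrn : ENNReal.ofReal (q x) = (massMeasure q).rnDeriv μ x.toLattice * μ {x.toLattice} := by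
    have := Measure.haveLebesgueDecomposition_of_sigmaFinite (massMeasure q) μ
    have hwd := Measure.withDensity_rnDeriv_eq (massMeasure q) μ hac
    rw [← massMeasure_apply_singleton q x, ← lintegral_singleton,
      ← withDensity_apply _ (measurableSet_singleton _), hwd]
  have hreal : q x = ((massMeasure q).rnDeriv μ x.toLattice).toReal * (μ {x.toLattice}).toReal := by
    rw [← ENNReal.toReal_mul, ← hrn, ENNReal.toReal_ofReal (hq.1 x)]
  have hμr : r x ≤ (μ {x.toLattice}).toReal :=
    (ENNReal.ofReal_le_iff_le_toReal (measure_ne_top _ _)).1 (hμ x)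
  have hμ0 : 0 < (μ {x.toLattice}).toReal := (hr x).trans_le hμr
  have hrn0 : ((massMeasure q).rnDeriv μ x.toLattice).toReal ≠ 0 := by
    intro h0
    rw [h0, zero_mul] at hreal
    exact (hqpos x).ne' hreal
  have h2 : Real.log (q x) = llr (massMeasure q) μ x.toLattice +
      Real.log (μ {x.toLattice}).toReal := by
    conv_lhs => rw [hreal]
    rw [Real.log_mul hrn0 hμ0.ne']
    rfl
  have h3 := Real.log_le_log (hr x) hμr
  linarith

/-- The log-sum inequality passes from the marginal at the earlier forward time to the joint law of
both times, which is then factored through the later one. -/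
lemma relEntropy_step_le [NeZero S] {p r : State d S → ℝ} (hp : p ∈ stdSimplex ℝ (State d S))
    (hpos : ∀ x, 0 < p x) (hr : ∀ x, 0 < r x) {s : State d S → State d S → ℝ}
    (hs : ∀ z x, z ≠ x → 0 < s z x) {h : ℝ} (hh : 0 < h) :
    relEntropy p (fun y => ∑ x, r x * leapKernel s h x y) ≤
      relEntropy (forwardLaw p h) r + stepError p h s := by
  have hA : ∀ x y, 0 < p y * prodKernel h y x := fun x y =>
    mul_pos (hpos y) (prodKernel_pos hh y x)
  have hK : ∀ x y, 0 < leapKernel s h x y := leapKernel_pos hs hh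
  have h1 : ∀ y, p y * (Real.log (p y) - Real.log (∑ x, r x * leapKernel s h x y)) ≤
      ∑ x, p y * prodKernel h y x *
        (Real.log (p y * prodKernel h y x) - Real.log (r x * leapKernel s h x y)) := by
    intro y
    have := log_sum_le Finset.univ (fun x _ => hA x y) (b := fun x => r x * leapKernel s h x y)
      (fun x _ => mul_pos (hr x) (hK x y))
    rwa [← Finset.mul_sum, sum_prodKernel, mul_one] at this
  refine (Finset.sum_le_sum fun y _ => h1 y).trans (le_of_eq ?_)
  rw [Finset.sum_comm, relEntropy, stepError, ← Finset.sum_add_distrib]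
  refine Finset.sum_congr rfl fun x _ => ?_
  have hp' : 0 < forwardLaw p h x := forwardLaw_pos hp hh x
  conv_rhs => enter [1, 1]; rw [forwardLaw_eq_sum]
  rw [Finset.sum_mul, ← Finset.sum_add_distrib]
  refine Finset.sum_congr rfl fun y _ => ?_
  rw [Real.log_mul (hr x).ne' (hK x y).ne', Real.log_mul hp'.ne' (hK x y).ne']
  ring

/-! ### Total variation -/

/-- The chain has not moved by time `t` with probability at least `e^{-dt} ≥ 1 - dt`. -/
lemma tvDist_forwardLaw_le [NeZero S] {q : State d S → ℝ} (hq : q ∈ stdSimplex ℝ (State d S))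
    {t : ℝ} (ht : 0 < t) : tvDist q (forwardLaw q t) ≤ d * t := by
  classical
  have hS : (0 : ℝ) < S := Nat.cast_pos.2 (NeZero.pos S)
  have hdiag : ∀ y : State d S, 1 - d * t ≤ prodKernel t y y := by
    intro y
    have h1 : ∏ _i : Fin d, Real.exp (-t) ≤ prodKernel t y y := by
      refine Finset.prod_le_prod (fun _ _ => (Real.exp_pos _).le) fun i _ => ?_
      have : 0 ≤ (1 - Real.exp (-t)) / S :=
        div_nonneg (sub_nonneg.2 (Real.exp_le_one_iff.2 (by linarith))) hS.le
      simpa [tokenKernel] using this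
    rw [Finset.prod_const, Finset.card_univ, Fintype.card_fin, ← Real.exp_nat_mul] at h1
    have h2 := Real.add_one_le_exp ((d : ℝ) * -t)
    linarith
  have h1 : ∀ x, |q x - forwardLaw q t x| ≤
      ∑ y, q y * |(if x = y then 1 else 0) - prodKernel t y x| := by
    intro x
    have : q x - forwardLaw q t x = ∑ y, q y * ((if x = y then 1 else 0) - prodKernel t y x) := by
      simp [mul_sub, Finset.sum_sub_distrib, forwardLaw_eq_sum]
    rw [this]
    refine (Finset.abs_sum_le_sum_abs _ _).trans (le_of_eq ?_)
    exact Finset.sum_congr rfl fun y _ => by rw [abs_mul, abs_of_nonneg (hq.1 y)]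
  have h2 : ∀ y : State d S, ∑ x, |(if x = y then 1 else 0) - prodKernel t y x| ≤ 2 * (d * t) := by
    intro y
    have h3 := sum_prodKernel t y
    rw [← Finset.add_sum_erase _ _ (Finset.mem_univ y)] at h3 ⊢
    have hy : prodKernel t y y ≤ 1 := by
      have : 0 ≤ ∑ x ∈ Finset.univ.erase y, prodKernel t y x :=
        Finset.sum_nonneg fun x _ => (prodKernel_pos ht _ _).le
      linarith
    have h4 : ∑ x ∈ Finset.univ.erase y, |(if x = y then 1 else 0) - prodKernel t y x| =
        ∑ x ∈ Finset.univ.erase y, prodKernel t y x := by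
      refine Finset.sum_congr rfl fun x hx => ?_
      rw [if_neg (Finset.ne_of_mem_erase hx), zero_sub, abs_neg,
        abs_of_pos (prodKernel_pos ht _ _)]
    rw [h4, if_pos rfl, abs_of_nonneg (sub_nonneg.2 hy)]
    linarith [hdiag y]
  have h5 : ∑ x, |q x - forwardLaw q t x| ≤ 2 * (d * t) := by
    refine (Finset.sum_le_sum fun x _ => h1 x).trans ?_
    rw [Finset.sum_comm]
    simp only [← Finset.mul_sum]
    refine (Finset.sum_le_sum fun y _ => mul_le_mul_of_nonneg_left (h2 y) (hq.1 y)).trans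
      (le_of_eq ?_)
    rw [← Finset.sum_mul, hq.2, one_mul]
  unfold tvDist
  linarith

/-! ### Summation over the grid -/

lemma log_le_half (x : ℝ) (hx : 0 < x) : Real.log x ≤ x / 2 := by
  have h1 := Real.log_le_sub_one_of_pos (half_pos hx)
  rw [Real.log_div hx.ne' two_ne_zero] at h1
  linarith [Real.log_two_lt_d9]

/-- Uses `log (1 + y²) ≤ 2y` with `y = √(c/v)` and `v - u ≤ 2√v (√v - √u)`; the resulting bound
telescopes over the grid. -/
lemma step_mul_log_le {u v c : ℝ} (hu : 0 ≤ u) (huv : u < v) (hc : 0 ≤ c) :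
    (v - u) * Real.log (1 + c / v) ≤ 4 * √c * (√v - √u) := by
  have hv : 0 < v := hu.trans_lt huv
  have hsv : 0 < √v := Real.sqrt_pos.2 hv
  have hle : √u ≤ √v := Real.sqrt_le_sqrt huv.le
  have h1 : Real.log (1 + c / v) ≤ 2 * (√c / √v) := by
    have h2 : 1 + c / v ≤ Real.exp (2 * (√c / √v)) := by
      have h3 : c / v = (√c / √v) ^ 2 := by rw [div_pow, Real.sq_sqrt hc, Real.sq_sqrt hv.le]
      have h4 : 0 ≤ √c / √v := by positivity
      have h5 := Real.quadratic_le_exp_of_nonneg (mul_nonneg zero_le_two h4)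
      rw [h3]
      nlinarith
    have h6 := Real.log_le_log (by positivity) h2
    rwa [Real.log_exp] at h6
  have h7 : v - u = (√v - √u) * (√v + √u) := by
    have e1 := Real.sq_sqrt hv.le
    have e2 := Real.sq_sqrt hu
    nlinarith
  calc (v - u) * Real.log (1 + c / v) ≤ (v - u) * (2 * (√c / √v)) :=
        mul_le_mul_of_nonneg_left h1 (by linarith)
    _ ≤ ((√v - √u) * (2 * √v)) * (2 * (√c / √v)) := by
        refine mul_le_mul_of_nonneg_right ?_ (by positivity)
        rw [h7]
        exact mul_le_mul_of_nonneg_left (by linarith) (by linarith)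
    _ = 4 * √c * (√v - √u) := by
        field_simp
        ring

/-- The error of the right-endpoint Riemann sum of the negative derivative `J` of a convex `E`,
on a grid that is refined towards zero. -/
lemma sum_convexity_error_le {E J : ℝ → ℝ} {A κ : ℝ} (hA : 0 ≤ A)
    (hEJ : ∀ u v, 0 < u → u < v → (v - u) * J v ≤ E u - E v ∧ E u - E v ≤ (v - u) * J u)
    (hJ : ∀ t, 0 < t → 0 ≤ J t) (htJ : ∀ t, 0 < t → t * J t ≤ 2 * A)
    (hE : ∀ t, 0 < t → -A ≤ E t ∧ E t ≤ 0)
    {N : ℕ} {τ : ℕ → ℝ} (hτ : ∀ k ≤ N, 0 < τ k) (hlt : ∀ k < N, τ (k + 1) < τ k)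
    (hκ : 0 < κ) (hstep : ∀ k < N, τ k - τ (k + 1) ≤ κ * min 1 (τ k)) :
    ∑ k ∈ Finset.range N, (E (τ (k + 1)) - E (τ k) - (τ k - τ (k + 1)) * J (τ k)) ≤
      6 * κ * A := by
  have hend := hE _ (hτ N le_rfl)
  have hstart := hE _ (hτ 0 (Nat.zero_le _))
  -- For `κ ≥ 1/2` dropping `J ≥ 0` and telescoping `E` already gives `A`. For `κ < 1/2` consecutive
  -- times differ by a factor at most 2.
  rcases le_or_gt (1 / 2) κ with h | h
  · have h1 : ∑ k ∈ Finset.range N, (E (τ (k + 1)) - E (τ k) - (τ k - τ (k + 1)) * J (τ k)) ≤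
        ∑ k ∈ Finset.range N, (E (τ (k + 1)) - E (τ k)) := by
      refine Finset.sum_le_sum fun k hk => ?_
      have hk' := Finset.mem_range.1 hk
      have := mul_nonneg (sub_pos.2 (hlt k hk')).le (hJ _ (hτ k hk'.le))
      linarith
    rw [Finset.sum_range_sub (fun k => E (τ k))] at h1
    nlinarith
  · have h1 : ∀ k ∈ Finset.range N, E (τ (k + 1)) - E (τ k) - (τ k - τ (k + 1)) * J (τ k) ≤
        2 * κ * ((min 1 (τ (k + 1)) * J (τ (k + 1)) + E (τ (k + 1))) -
          (min 1 (τ k) * J (τ k) + E (τ k))) := by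
      intro k hk
      have hk' := Finset.mem_range.1 hk
      have hu := hτ (k + 1) hk'
      have hv := hτ k hk'.le
      have huv := hlt k hk'
      obtain ⟨b1, b2⟩ := hEJ _ _ hu huv
      have hs := hstep k hk'
      have hJv := hJ _ hv
      set u := τ (k + 1)
      set v := τ k
      have hmono : J v ≤ J u := by
        have := b1.trans b2
        exact le_of_mul_le_mul_left this (sub_pos.2 huv)
      have hmv : min 1 v ≤ v := min_le_right _ _
      have hm : min 1 v ≤ 2 * min 1 u := by
        have : v ≤ 2 * u := by nlinarith
        rcases min_choice 1 u with h2 | h2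
        · rw [h2]; linarith [min_le_left 1 v]
        · rw [h2]; linarith
      have hm2 : min 1 v - min 1 u ≤ v - u := by
        rcases min_choice 1 u with h2 | h2
        · rw [h2]; linarith [min_le_left 1 v]
        · rw [h2]; linarith
      have c1 : (v - u) * (J u - J v) ≤ 2 * κ * (min 1 u * (J u - J v)) := by
        have h3 : v - u ≤ 2 * κ * min 1 u := by nlinarith
        have := mul_le_mul_of_nonneg_right h3 (sub_nonneg.2 hmono)
        linarith
      have c2 : min 1 u * (J u - J v) ≤ min 1 u * J u - min 1 v * J v + (E u - E v) := by
        have := mul_le_mul_of_nonneg_right hm2 hJv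
        linarith
      have c3 := mul_le_mul_of_nonneg_left c2 (by linarith : 0 ≤ 2 * κ)
      have c4 : E u - E v - (v - u) * J v ≤ (v - u) * (J u - J v) := by linarith
      linarith
    refine (Finset.sum_le_sum h1).trans ?_
    rw [← Finset.mul_sum, Finset.sum_range_sub (fun k => min 1 (τ k) * J (τ k) + E (τ k))]
    have e1 : min 1 (τ N) * J (τ N) ≤ 2 * A :=
      (mul_le_mul_of_nonneg_right (min_le_right _ _) (hJ _ (hτ N le_rfl))).trans
        (htJ _ (hτ N le_rfl))
    have e2 : 0 ≤ min 1 (τ 0) * J (τ 0) :=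
      mul_nonneg (le_min zero_le_one (hτ 0 (Nat.zero_le _)).le) (hJ _ (hτ 0 (Nat.zero_le _)))
    nlinarith

section grid

variable {q₀ : State d S → ℝ} {T δ κ M εscore : ℝ} {N : ℕ} {t : ℕ → ℝ}
  {s : ℝ → State d S → State d S → ℝ}

lemma IsGrid.le_sub (hg : IsGrid T δ N t) : ∀ k ≤ N, δ ≤ T - t k := by
  intro k hk
  induction hk using Nat.decreasingInduction with
  | self => rw [hg.last]; linarith
  | of_succ k hk ih => linarith [hg.lt_succ k hk]

lemma scoreError_nonneg [NeZero S] (hq : q₀ ∈ stdSimplex ℝ (State d S)) (hδ : 0 < δ) (hM : 1 ≤ M)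
    (hg : IsGrid T δ N t) (hse : ScoreError q₀ T N t s εscore) (hsb : ScoreBounded T N t s M) :
    0 ≤ εscore := by
  refine le_trans (Finset.sum_nonneg fun k hk => ?_) hse
  have hk' := Finset.mem_range.1 hk
  refine mul_nonneg (sub_pos.2 (hg.lt_succ k hk')).le (scoreEntropy_nonneg hq
    (hδ.trans_le (hg.le_sub k hk'.le)) fun z x hzx => ?_)
  exact (inv_pos.2 (by linarith : 0 < M)).trans_le (hsb k hk' z x hzx).1

lemma relEntropy_leapLaw_le [NeZero S] (hq : q₀ ∈ stdSimplex ℝ (State d S)) (hδ : 0 < δ)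
    (hg : IsGrid T δ N t) (hs : ∀ k < N, ∀ z x, z ≠ x → 0 < s (T - t k) z x) :
    ∀ k ≤ N, relEntropy (forwardLaw q₀ (T - t k)) (leapLaw T t s k) ≤
      d * Real.log S * Real.exp (-T) + ∑ j ∈ Finset.range k,
        stepError (forwardLaw q₀ (T - t (j + 1))) (t (j + 1) - t j) (s (T - t j)) := by
  have hS : (0 : ℝ) < S := Nat.cast_pos.2 (NeZero.pos S)
  intro k
  induction k with
  | zero =>
    intro _
    have hT : 0 < T := by
      have := hg.le_sub 0 (Nat.zero_le _)
      rw [hg.zero] at this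
      linarith
    have h1 := negEntropy_forwardLaw_le hq hT
    have h2 := sum_forwardLaw q₀ T
    rw [hq.2] at h2
    rw [hg.zero, sub_zero, Finset.sum_range_zero, add_zero]
    refine le_trans (le_of_eq ?_) h1
    simp only [relEntropy, leapLaw, mul_sub, Finset.sum_sub_distrib, ← Finset.sum_mul, h2]
    rw [one_mul, one_div, Real.log_inv, Real.log_pow, negEntropy]
    ring
  | succ k ih =>
    intro hk
    have hu : 0 < T - t (k + 1) := hδ.trans_le (hg.le_sub _ hk)
    have h1 := relEntropy_step_le (forwardLaw_mem_stdSimplex hq hu) (forwardLaw_pos hq hu)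
      (leapLaw_pos hg.lt_succ hs k (by omega)) (hs k hk) (sub_pos.2 (hg.lt_succ k hk))
    rw [← forwardLaw_add, sub_add_sub_cancel] at h1
    rw [Finset.sum_range_succ]
    have h2 := ih (by omega)
    simp only [leapLaw]
    linarith

lemma one_add_log_le_bound [NeZero S] (hδ : 0 < δ) (hδT : δ < T) (hM : 1 ≤ M) :
    1 + Real.log M + Real.log S ≤ T + Real.log (M * S * δ⁻¹) ∧
      T / 2 ≤ T + Real.log (M * S * δ⁻¹) ∧
      T + Real.log (M * S * δ⁻¹) = T + Real.log M + Real.log S - Real.log δ := by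
  have hS : (1 : ℝ) ≤ S := Nat.one_le_cast.2 (NeZero.pos S)
  have e : Real.log (M * S * δ⁻¹) = Real.log M + Real.log S - Real.log δ := by
    rw [Real.log_mul (by positivity) (by positivity), Real.log_mul (by positivity) (by positivity),
      Real.log_inv]
    ring
  have h1 := Real.log_le_sub_one_of_pos hδ
  have h2 := log_le_half δ hδ
  have h3 := Real.log_nonneg hM
  have h4 := Real.log_nonneg hS
  rw [e]
  refine ⟨by linarith, by linarith, by ring⟩

lemma klDiv_tauLeapLaw_le (hd : 0 < d) [NeZero S] (hq : q₀ ∈ stdSimplex ℝ (State d S))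
    (hδ : 0 < δ) (hδT : δ < T) (hκ : 0 < κ) (hM : 1 ≤ M) (hg : IsGrid T δ N t)
    (hstep : ∀ k < N, t (k + 1) - t k ≤ κ * min 1 (T - t k))
    (hse : ScoreError q₀ T N t s εscore) (hsb : ScoreBounded T N t s M)
    (out : ℕ → Kernel (Lattice d) (Lattice d)) (hout : ∀ k, IsMarkovKernel (out k)) :
    klDiv (massMeasure (forwardLaw q₀ δ)) (tauLeapLaw T t s out N) ≤
      ENNReal.ofReal (d * Real.log S * Real.exp (-T) + 7 * εscore +
        58 * (κ * d ^ 2 * S * (T + Real.log (M * S * δ⁻¹)))) := by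
  have hS1 : (1 : ℝ) ≤ S := Nat.one_le_cast.2 (NeZero.pos S)
  have hT : 0 < T := hδ.trans hδT
  have hs0 : ∀ k < N, ∀ z x, z ≠ x → 0 < s (T - t k) z x := fun k hk z x hzx =>
    (inv_pos.2 (by linarith : 0 < M)).trans_le (hsb k hk z x hzx).1
  have hlast : T - t N = δ := by rw [hg.last]; ring
  have hprob := tauLeapLaw_isProbabilityMeasure T t s out hout N
  refine (klDiv_massMeasure_le (forwardLaw_mem_stdSimplex hq hδ) (forwardLaw_pos hq hδ)
    (leapLaw_pos hg.lt_succ hs0 N le_rfl) _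
    (leapLaw_le_tauLeapLaw out hg.lt_succ hs0 N le_rfl)).trans (ENNReal.ofReal_le_ofReal ?_)
  have hmain := relEntropy_leapLaw_le hq hδ hg hs0 N le_rfl
  rw [hlast] at hmain
  refine hmain.trans ?_
  set τ : ℕ → ℝ := fun k => T - t k with hτ
  have hτpos : ∀ k ≤ N, 0 < τ k := fun k hk => hδ.trans_le (hg.le_sub k hk)
  have hτlt : ∀ k < N, τ (k + 1) < τ k := fun k hk => by
    have := hg.lt_succ k hk
    simp only [hτ]; linarith
  have hdiff : ∀ k, t (k + 1) - t k = τ k - τ (k + 1) := fun k => by simp only [hτ]; ring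
  have hτ0 : τ 0 = T := by simp only [hτ, hg.zero, sub_zero]
  have hlogS : 0 ≤ Real.log S := Real.log_nonneg hS1
  have hlogM : 0 ≤ Real.log M := Real.log_nonneg hM
  set Ent : ℝ → ℝ := fun v => negEntropy (forwardLaw q₀ v) with hEnt
  set J : ℝ → ℝ := fun v => dissipation (forwardLaw q₀ v) with hJ
  have hone : ∀ k ∈ Finset.range N,
      stepError (forwardLaw q₀ (T - t (k + 1))) (t (k + 1) - t k) (s (T - t k)) ≤
        7 * ((t (k + 1) - t k) * scoreEntropy q₀ (T - t k) (s (T - t k))) +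
        (Ent (τ (k + 1)) - Ent (τ k) - (τ k - τ (k + 1)) * J (τ k)) +
        κ * d * (15 / 2 * (τ k - τ (k + 1)) + 24 * √S * (√(τ k) - √(τ (k + 1)))) +
        κ * d * ((min (τ k) (Real.log S + 1) - min (τ (k + 1)) (Real.log S + 1)) *
          Real.log M) := by
    intro k hk
    have hk' := Finset.mem_range.1 hk
    have h1 := stepError_forwardLaw_le hq (hτpos (k + 1) hk') (sub_pos.2 (hg.lt_succ k hk'))
      (κ := κ) (M := M) (s := s (T - t k)) (by
        rw [show τ (k + 1) + (t (k + 1) - t k) = T - t k by simp only [hτ]; ring]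
        exact hstep k hk') hM (hsb k hk')
    rw [show τ (k + 1) + (t (k + 1) - t k) = τ k by simp only [hτ]; ring, hdiff k] at h1
    have h2 := step_mul_log_le (hτpos (k + 1) hk').le (hτlt k hk') (c := S) (by linarith)
    have h3 : κ * d * ((τ k - τ (k + 1)) * (15 / 2 + 6 * Real.log (1 + S / τ k))) ≤
        κ * d * (15 / 2 * (τ k - τ (k + 1)) + 24 * √S * (√(τ k) - √(τ (k + 1)))) := by
      refine mul_le_mul_of_nonneg_left ?_ (by positivity)
      linarith
    rw [hdiff k]
    simp only [hEnt, hJ]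
    linarith
  have hsum := Finset.sum_le_sum hone
  rw [Finset.sum_add_distrib, Finset.sum_add_distrib, Finset.sum_add_distrib, ← Finset.mul_sum,
    ← Finset.mul_sum, ← Finset.mul_sum, Finset.sum_add_distrib, ← Finset.mul_sum, ← Finset.mul_sum,
    ← Finset.sum_mul, Finset.sum_range_sub' τ, Finset.sum_range_sub' (fun k => √(τ k)),
    Finset.sum_range_sub' (fun k => min (τ k) (Real.log S + 1))] at hsum
  have hA := sum_convexity_error_le (E := Ent) (J := J) (A := d * Real.log S) (κ := κ)
    (by positivity) (fun u v hu huv => negEntropy_sub_bounds hq hu huv)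
    (fun v hv => dissipation_nonneg hq hv) (fun v hv => dissipation_mul_le hq hv)
    (fun v hv => ⟨neg_log_card_le_negEntropy (forwardLaw_mem_stdSimplex hq hv)
      (forwardLaw_pos hq hv), negEntropy_nonpos (forwardLaw_mem_stdSimplex hq hv)⟩)
    hτpos hτlt hκ (fun k hk => by rw [← hdiff k]; exact hstep k hk)
  have hse' : ∑ k ∈ Finset.range N, (t (k + 1) - t k) * scoreEntropy q₀ (T - t k) (s (T - t k)) ≤
    εscore := hse
  obtain ⟨hB1, hB2, -⟩ := one_add_log_le_bound (S := S) hδ hδT hM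
  set B := T + Real.log (M * S * δ⁻¹) with hB
  rw [hτ0] at hsum
  have hN := hτpos N le_rfl
  -- With `log S ≤ B`, `T ≤ 2 B` and `√T ≤ 3/2 B`, the four terms cost 6, 15, 36 and 1 times `S B`.
  have hcollect : 6 * Real.log S + (15 / 2 * (T - τ N) + 24 * √S * (√T - √(τ N))) +
      (min T (Real.log S + 1) - min (τ N) (Real.log S + 1)) * Real.log M ≤ 58 * (S * B) := by
    have hB0 : 1 ≤ B := by linarith
    have hSB : B ≤ S * B := le_mul_of_one_le_left (by linarith) hS1
    have i1 : √S ≤ S := by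
      rw [Real.sqrt_le_left (by linarith)]
      nlinarith
    have i2 : √T - √(τ N) ≤ 3 / 2 * B := by
      have : √T ≤ (1 + T) / 2 := by
        rw [Real.sqrt_le_left (by linarith)]
        nlinarith [sq_nonneg (T - 1)]
      linarith [Real.sqrt_nonneg (τ N)]
    have i3 : √S * (√T - √(τ N)) ≤ S * (3 / 2 * B) := by
      calc √S * (√T - √(τ N)) ≤ √S * (3 / 2 * B) :=
            mul_le_mul_of_nonneg_left i2 (Real.sqrt_nonneg _)
        _ ≤ _ := mul_le_mul_of_nonneg_right i1 (by linarith)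
    have i4 : (min T (Real.log S + 1) - min (τ N) (Real.log S + 1)) * Real.log M ≤ S * B := by
      have j1 : min T (Real.log S + 1) - min (τ N) (Real.log S + 1) ≤ S := by
        have := Real.log_le_sub_one_of_pos (by linarith : (0 : ℝ) < S)
        have j2 : min T (Real.log S + 1) ≤ Real.log S + 1 := min_le_right _ _
        have j3 : 0 ≤ min (τ N) (Real.log S + 1) := le_min hN.le (by linarith)
        linarith
      calc _ ≤ S * Real.log M := mul_le_mul_of_nonneg_right j1 hlogM
        _ ≤ S * B := mul_le_mul_of_nonneg_left (by linarith) (by linarith)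
    linarith
  have hd1 : (d : ℝ) ≤ d ^ 2 := by
    have : (1 : ℝ) ≤ d := Nat.one_le_cast.2 hd
    nlinarith
  have hfin : κ * d * (58 * (S * B)) ≤ 58 * (κ * d ^ 2 * S * B) := by
    have : κ * d * (S * B) ≤ κ * d ^ 2 * (S * B) := by
      refine mul_le_mul_of_nonneg_right (mul_le_mul_of_nonneg_left hd1 hκ.le) ?_
      have : 0 ≤ B := by linarith
      positivity
    linarith
  have hcol2 := mul_le_mul_of_nonneg_left hcollect (by positivity : 0 ≤ κ * d)
  have : 6 * κ * (d * Real.log S) = κ * d * (6 * Real.log S) := by ring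
  linarith

end grid

/-! ### A grid with exactly proportional steps -/

/-- The remaining times `T - t k` of the grid with steps `κ * min 1 (T - t k)`. -/
def remainingTime (T κ : ℝ) : ℕ → ℝ
  | 0 => T
  | k + 1 => remainingTime T κ k - κ * min 1 (remainingTime T κ k)

lemma continuous_remainingTime (T : ℝ) (k : ℕ) : Continuous fun κ => remainingTime T κ k := by
  induction k with
  | zero => exact continuous_const
  | succ k ih =>
    simp only [remainingTime]
    fun_prop

lemma remainingTime_zero (T : ℝ) (k : ℕ) : remainingTime T 0 k = T := by
  induction k with
  | zero => rfl
  | succ k ih => simp [remainingTime, ih]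

lemma remainingTime_one_le (T : ℝ) (k : ℕ) :
    remainingTime T 1 k ≤ max (T - k) 0 := by
  induction k with
  | zero => simp [remainingTime]
  | succ k ih =>
    simp only [remainingTime, one_mul, Nat.cast_succ]
    rcases le_total 1 (remainingTime T 1 k) with h | h
    · rw [min_eq_left h]
      rcases le_max_iff.1 (h.trans ih) with h2 | h2
      · rw [max_eq_left (by linarith)] at ih
        exact le_max_of_le_left (by linarith)
      · norm_num at h2
    · rw [min_eq_right h, sub_self]
      exact le_max_right _ _

lemma remainingTime_pos {T κ : ℝ} (hT : 0 < T) (hκ : 0 ≤ κ) (hκ1 : κ < 1) (k : ℕ) :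
    0 < remainingTime T κ k := by
  induction k with
  | zero => exact hT
  | succ k ih =>
    simp only [remainingTime]
    have h1 : κ * min 1 (remainingTime T κ k) ≤ κ * remainingTime T κ k :=
      mul_le_mul_of_nonneg_left (min_le_right _ _) hκ
    nlinarith

/-- One step lowers `v + log v` by at least `κ (min(1, v) + min(1, v) / v) ≥ κ`: the linear part
counts steps while `v ≥ 1`, the logarithm those below. -/
lemma mul_le_potential_sub {T κ : ℝ} (hT : 0 < T) (hκ : 0 ≤ κ) (hκ1 : κ < 1) (k : ℕ) :
    k * κ ≤ (T + Real.log T) - (remainingTime T κ k + Real.log (remainingTime T κ k)) := by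
  induction k with
  | zero => simp [remainingTime]
  | succ k ih =>
    have hv := remainingTime_pos hT hκ hκ1 k
    have hu := remainingTime_pos hT hκ hκ1 (k + 1)
    simp only [remainingTime] at hu ⊢
    set v := remainingTime T κ k
    have h1 := Real.log_le_sub_one_of_pos (div_pos hu hv)
    rw [Real.log_div hu.ne' hv.ne'] at h1
    have h2 : (v - κ * min 1 v) / v - 1 = -(κ * (min 1 v / v)) := by
      field_simp
      ring
    have h3 : 1 ≤ min 1 v + min 1 v / v := by
      rcases le_total 1 v with h | h
      · rw [min_eq_left h]
        have : 0 ≤ 1 / v := by positivity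
        linarith
      · rw [min_eq_right h, div_self hv.ne']
        linarith
    have h4 := mul_le_mul_of_nonneg_left h3 hκ
    push_cast
    linarith

/-- With `κ = 0` the time stays at `T`; with `κ = 1` it is exhausted after `N ≥ T` steps. Continuity
in `κ` does the rest. -/
lemma exists_remainingTime_eq {T δ : ℝ} (hδ : 0 < δ) (hδT : δ < T) {N : ℕ} (hN : T ≤ N) :
    ∃ κ, 0 < κ ∧ κ < 1 ∧ remainingTime T κ N = δ := by
  have h1 : remainingTime T 1 N ≤ 0 := by
    have := remainingTime_one_le T N
    rwa [max_eq_right (by linarith)] at this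
  have hmem : δ ∈ Set.Icc (remainingTime T 1 N) (remainingTime T 0 N) := by
    rw [remainingTime_zero]
    exact ⟨by linarith, hδT.le⟩
  obtain ⟨κ, hκ, hκδ⟩ := intermediate_value_Icc' zero_le_one
    (continuous_remainingTime T N).continuousOn hmem
  refine ⟨κ, lt_of_le_of_ne hκ.1 ?_, lt_of_le_of_ne hκ.2 ?_, hκδ⟩
  · rintro rfl
    have : remainingTime T 0 N = δ := hκδ
    rw [remainingTime_zero] at this
    linarith
  · rintro rfl
    have : remainingTime T 1 N = δ := hκδ
    linarith

lemma exists_proportional_grid {T δ : ℝ} (hδ : 0 < δ) (hδT : δ < T) {N : ℕ} (hN : T ≤ N) :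
    ∃ (κ : ℝ) (t : ℕ → ℝ), 0 < κ ∧ IsGrid T δ N t ∧
      (∀ k < N, t (k + 1) - t k = κ * min 1 (T - t k)) ∧
      N * κ ≤ (T + Real.log T) - (δ + Real.log δ) := by
  obtain ⟨κ, hκ0, hκ1, hκ⟩ := exists_remainingTime_eq hδ hδT hN
  have hT := hδ.trans hδT
  have hpos := remainingTime_pos hT hκ0.le hκ1
  refine ⟨κ, fun k => T - remainingTime T κ k, hκ0, ⟨?_, ?_, fun k _ => ?_⟩, fun k _ => ?_, ?_⟩
  · simp [remainingTime]
  · simp only [hκ]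
  · have : 0 < κ * min 1 (remainingTime T κ k) := mul_pos hκ0 (lt_min one_pos (hpos k))
    simp only [remainingTime]
    linarith
  · simp only [remainingTime]
    rw [sub_sub_cancel]
    ring
  · have := mul_le_potential_sub hT hκ0.le hκ1 N
    rwa [hκ] at this

end

end DiscreteDiffusion

/-! ### Assembly of the two claims -/

open DiscreteDiffusion in
theorem theorem2 :
    ∃ C : ℝ, 0 < C ∧
      -- error bound for every admissible grid
      (∀ (d S : ℕ) (q₀ : State d S → ℝ) (T δ κ M εscore : ℝ) (N : ℕ) (t : ℕ → ℝ)
          (s : ℝ → State d S → State d S → ℝ)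
          (out : ℕ → Kernel (Lattice d) (Lattice d)),
        0 < d → 0 < S → q₀ ∈ stdSimplex ℝ (State d S) →
        0 < δ → δ < T → 0 < κ → 1 ≤ M →
        IsGrid T δ N t →
        (∀ k < N, t (k + 1) - t k ≤ κ * min 1 (T - t k)) →
        ScoreError q₀ T N t s εscore →
        ScoreBounded T N t s M →
        (∀ k, IsMarkovKernel (out k)) →
        klDiv (massMeasure (forwardLaw q₀ δ)) (tauLeapLaw T t s out N) ≤
            ENNReal.ofReal (C * (d * Real.log S * Real.exp (-T) + εscore
              + κ * d ^ 2 * S * (T + Real.log (M * S * δ⁻¹)))) ∧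
          tvDist q₀ (forwardLaw q₀ δ) ≤ C * (d * δ)) ∧
      -- number of steps for accuracy `ε`
      (∀ (d S : ℕ) (T δ ε M : ℝ),
        0 < d → 0 < S → 0 < ε → 1 ≤ M → T = Real.log (d * Real.log S / ε) → 0 < δ → δ < T →
        ∃ (N : ℕ) (κ : ℝ) (t : ℕ → ℝ),
          0 < κ ∧ IsGrid T δ N t ∧
          (∀ k < N, t (k + 1) - t k = κ * min 1 (T - t k)) ∧
          (N : ℝ) ≤ C * (d ^ 2 * S / ε) * Real.log (d * S * M / (δ * ε)) ^ 2 ∧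
          ∀ (q₀ : State d S → ℝ) (εscore : ℝ) (s : ℝ → State d S → State d S → ℝ)
              (out : ℕ → Kernel (Lattice d) (Lattice d)),
            q₀ ∈ stdSimplex ℝ (State d S) →
            ScoreError q₀ T N t s εscore →
            ScoreBounded T N t s M →
            (∀ k, IsMarkovKernel (out k)) →
            klDiv (massMeasure (forwardLaw q₀ δ)) (tauLeapLaw T t s out N) ≤
              ENNReal.ofReal (C * (ε + εscore))) := by

  -- Any constant from 59 on would do: 58 from the discretization, plus 1 from the initial error in
  -- the second part.
  refine ⟨200, by norm_num, ?_, ?_⟩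
  · intro d S q₀ T δ κ M εscore N t s out hd hS hq hδ hδT hκ hM hg hstep hse hsb hout
    have : NeZero S := ⟨hS.ne'⟩
    have hS1 : (1 : ℝ) ≤ S := Nat.one_le_cast.2 hS
    refine ⟨(klDiv_tauLeapLaw_le hd hq hδ hδT hκ hM hg hstep hse hsb out hout).trans
      (ENNReal.ofReal_le_ofReal ?_), (tvDist_forwardLaw_le hq hδ).trans ?_⟩
    · have h1 := scoreError_nonneg hq hδ hM hg hse hsb
      have h2 : 0 ≤ d * Real.log S * Real.exp (-T) := by
        have := Real.log_nonneg hS1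
        positivity
      have h3 : 0 ≤ κ * d ^ 2 * S * (T + Real.log (M * S * δ⁻¹)) := by
        obtain ⟨hB, -, -⟩ := one_add_log_le_bound (S := S) hδ hδT hM
        have hB0 : 0 ≤ T + Real.log (M * S * δ⁻¹) := by
          linarith [Real.log_nonneg hS1, Real.log_nonneg hM]
        positivity
      linarith
    · have : 0 ≤ (d : ℝ) * δ := by positivity
      linarith
  · intro d S T δ ε M hd hS hε hM hT hδ hδT
    have : NeZero S := ⟨hS.ne'⟩
    have hS1 : (1 : ℝ) ≤ S := Nat.one_le_cast.2 hS
    have hd1 : (1 : ℝ) ≤ d := Nat.one_le_cast.2 hd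
    have hTpos : 0 < T := hδ.trans hδT
    have hlogS0 : 0 ≤ Real.log S := Real.log_nonneg hS1
    -- Positivity of `T` forces `ε < d log S`; this excludes `S = 1` and gives `D ≥ 1` below.
    have harg : 1 < d * Real.log S / ε := by
      by_contra hneg
      push Not at hneg
      have := Real.log_nonpos (by positivity) hneg
      linarith
    have hlogS : 0 < Real.log S := by
      rcases hlogS0.eq_or_lt with h | h
      · rw [← h, mul_zero, zero_div] at harg
        linarith
      · exact h
    have hexpT : d * Real.log S * Real.exp (-T) = ε := by
      rw [Real.exp_neg, hT, Real.exp_log (by linarith)]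
      field_simp
    obtain ⟨hB1, hB2, hBeq⟩ := one_add_log_le_bound (S := S) hδ hδT hM
    set B := T + Real.log (M * S * δ⁻¹) with hB
    have hlogM := Real.log_nonneg hM
    have hBone : 1 ≤ B := by linarith
    set D : ℝ := d ^ 2 * S / ε with hD
    have hD1 : 1 ≤ D := by
      rw [lt_div_iff₀ hε, one_mul] at harg
      rw [hD, le_div_iff₀ hε, one_mul]
      have h1 := Real.log_le_sub_one_of_pos (by linarith : (0 : ℝ) < S)
      have h2 : d * Real.log S ≤ d ^ 2 * S := by
        have : (d : ℝ) ≤ d ^ 2 := by nlinarith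
        exact mul_le_mul this (by linarith) hlogS0 (by positivity)
      linarith
    -- The logarithm on the right equals `B - log log S`, and `log log S ≤ (log S) / 2 ≤ B / 2`.
    have hBL : B ≤ 2 * Real.log (d * S * M / (δ * ε)) := by
      have e1 : Real.log (d * S * M / (δ * ε)) =
          Real.log d + Real.log S + Real.log M - (Real.log δ + Real.log ε) := by
        rw [Real.log_div (by positivity) (by positivity), Real.log_mul (by positivity)
          (by positivity), Real.log_mul (by positivity) (by positivity),
          Real.log_mul hδ.ne' hε.ne']
      have e2 : T = Real.log d + Real.log (Real.log S) - Real.log ε := by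
        rw [hT, Real.log_div (by positivity) hε.ne', Real.log_mul (by positivity) hlogS.ne']
      have e3 := log_le_half _ hlogS
      rw [e1]
      linarith
    -- The summand `⌈T⌉₊` makes the grid exist. The other, combined with `N κ ≤ 2 B`, gives `κ B D ≤
    -- 1`, that is `κ d² S B ≤ ε`.
    set N : ℕ := ⌈2 * B ^ 2 * D⌉₊ + ⌈T⌉₊ with hN
    have hTN : T ≤ N := by
      rw [hN]
      push_cast
      have := Nat.le_ceil T
      have h2 : (0 : ℝ) ≤ ⌈2 * B ^ 2 * D⌉₊ := Nat.cast_nonneg _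
      linarith
    have hDN : 2 * B ^ 2 * D ≤ N := by
      rw [hN]
      push_cast
      have := Nat.le_ceil (2 * B ^ 2 * D)
      have h2 : (0 : ℝ) ≤ ⌈T⌉₊ := Nat.cast_nonneg _
      linarith
    obtain ⟨κ, t, hκ, hg, hstep, hNκ⟩ := exists_proportional_grid hδ hδT hTN
    refine ⟨N, κ, t, hκ, hg, hstep, ?_, ?_⟩
    · have h1 : (N : ℝ) ≤ 2 * B ^ 2 * D + 1 + (T + 1) := by
        rw [hN]
        push_cast
        have := Nat.ceil_lt_add_one (by positivity : 0 ≤ 2 * B ^ 2 * D)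
        have := Nat.ceil_lt_add_one hTpos.le
        linarith
      have h2 : B ≤ B ^ 2 := by nlinarith
      have h3 : B ^ 2 ≤ B ^ 2 * D := le_mul_of_one_le_right (by positivity) hD1
      have h4 : (N : ℝ) ≤ 6 * (B ^ 2 * D) := by linarith
      set Λ := Real.log (d * S * M / (δ * ε))
      have h5 : B ^ 2 ≤ 4 * Λ ^ 2 := by nlinarith
      have h6 := mul_le_mul_of_nonneg_right h5 (by linarith : 0 ≤ D)
      have h7 : 0 ≤ D * Λ ^ 2 := by positivity
      linarith
    · intro q₀ εscore s out hq hse hsb hout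
      refine (klDiv_tauLeapLaw_le hd hq hδ hδT hκ hM hg (fun k hk => (hstep k hk).le) hse hsb out
        hout).trans (ENNReal.ofReal_le_ofReal ?_)
      have h1 := scoreError_nonneg hq hδ hM hg hse hsb
      have h2 : N * κ ≤ 2 * B := by
        have := log_le_half T hTpos
        linarith
      have h3 : κ * d ^ 2 * S * B ≤ ε := by
        have e1 : d ^ 2 * S = D * ε := by rw [hD]; field_simp
        have e2 : κ * (2 * B ^ 2 * D) ≤ 2 * B := by
          have := mul_le_mul_of_nonneg_left hDN hκ.le
          linarith
        have e3 : κ * B * D ≤ 1 := by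
          have : (κ * B * D) * (2 * B) ≤ 1 * (2 * B) := by linarith
          exact le_of_mul_le_mul_right this (by linarith)
        calc κ * d ^ 2 * S * B = κ * B * D * ε := by rw [mul_assoc κ, e1]; ring
          _ ≤ 1 * ε := mul_le_mul_of_nonneg_right e3 hε.le
          _ = ε := one_mul ε
      rw [hexpT]
      linarith
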